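/- Let $\Omega\subset\mathbb R^2$ be open and let $f:\Omega\to\mathbb R^2$ be smooth. Suppose that $Df(u)$ has real eigenvalues $\lambda_1(u)<\lambda_2(u)$ with eigenvectors $r_1(u),r_2(u)$ for every $u\in\Omega$, and that $r_i\cdot\nabla\lambda_i\ge 0$ in $\Omega$ for $i=1,2$. Let $\overline u\in\Omega$, and let $w=(w_1,w_2)$ be Riemann coordinates near $\overline u$: a smooth diffeomorphism $u\mapsto w[u]$ from an open neighbourhood $N\subset\Omega$ of $\overline u$ onto an open subset of $\mathbb R^2$, with $\partial u/\partial w_i=r_i(u)$ for $i=1,2$. All wave curves below are taken in $N$ and parameterized by the jump of $w_i$, and $\sigma$ may have either sign: - $\mathcal R_i(\sigma;u)$ is the state at parameter $\sigma$ on the integral curve of $r_i$ starting at $u$. - $\mathcal S_i(\sigma;u)$ is the state at parameter $\sigma$ on the $i$-th Hugoniot curve starting at $u$, that is, the continuous curve $\gamma$ with $\gamma(0)=u$, $w_i[\gamma(s)]=w_i[u]+s$ and $f(\gamma(s))-f(u)=V(s)(\gamma(s)-u)$ for a continuous speed $V$ with $V(0)=\lambda_i(u)$. - $\mathcal T_i(\sigma;u)=\mathcal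 R_i(\sigma;u)$ if $\sigma\ge 0$, and $\mathcal T_i(\sigma;u)=\mathcal S_i(\sigma;u)$ if $\sigma\le 0$. Then there exist an open neighbourhood $U\subset N$ of $\overline u$ and constants $c>0$ and $C$ with the following properties. For each choice of $\mathcal U_1\in\{\mathcal R_1,\mathcal T_1\}$ and $\mathcal U_2\in\{\mathcal R_2,\mathcal T_2\}$, and for all $u_l,u_r\in U$, there is a unique pair $(\sigma_1,\sigma_2)\in(-c,c)^2$ such that $u_r=\mathcal U_2(\sigma_2;\mathcal U_1(\sigma_1;u_l))$. Moreover, for $i\in\{1,2\}$, all $u_l,u_m,u_r\in U$ and all $\sigma_i,\sigma_i'\in\mathbb R$: **1.** (Classical waves) If $u_m=\mathcal T_i(\sigma_i;u_l)$ and $u_r=\mathcal T_i(\sigma_i';u_m)$, then $u_r=\mathcal T_2(\widetilde\sigma_2;\mathcal T_1(\widetilde\sigma_1;u_l))$ for some $\widetilde\sigma_1,\widetilde\sigma_2\in(-c,c)$ with $$|\widetilde\sigma_i-\sigma_i-\sigma_i'|\le C|\sigma_i|^3|\sigma_i'|^3(|\sigma_i|+|\sigma_i'|)^3,\qquad |\widetilde\sigma_{3-i}|\le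 C|\sigma_i||\sigma_i'|(|\sigma_i|+|\sigma_i'|).$$ **2.** (Shocks and compression waves) If $\sigma_i<0$, $\sigma_i'<0$, and either $u_m=\mathcal T_i(\sigma_i;u_l)$ and $u_r=\mathcal R_i(\sigma_i';u_m)$, or $u_m=\mathcal R_i(\sigma_i';u_l)$ and $u_r=\mathcal T_i(\sigma_i;u_m)$, then $u_r=\mathcal T_2(\widetilde\sigma_2;\mathcal T_1(\widetilde\sigma_1;u_l))$ for some $\widetilde\sigma_1,\widetilde\sigma_2\in(-c,c)$ with $$|\widetilde\sigma_i-\sigma_i-\sigma_i'|\le C|\sigma_i'|^3(|\sigma_i|+|\sigma_i'|)^6,\qquad |\widetilde\sigma_{3-i}|\le C|\sigma_i'|(|\sigma_i|+|\sigma_i'|)^2.$$ **3.** (Compression and rarefaction waves) If $u_m=\mathcal R_i(\sigma_i';u_l)$ and $u_r=\mathcal R_i(\sigma_i;u_m)$, then $u_r=\mathcal R_i(\sigma_i+\sigma_i';u_l)$. -/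

import Mathlib

open scoped ContDiff

namespace WaveInteraction

/-- The plane of states `u = (u₁, u₂)`; family `1` has index `0`, family `2` has index `1`. -/
abbrev State : Type := Fin 2 → ℝ

/-- The system `u_t + f(u)_x = 0` on the open set `Ω` is strictly hyperbolic, with a smooth flux,
eigenvalues `lam 0 < lam 1` of `Df` and eigenvectors `r 0`, `r 1`, and both of its
characteristic fields are monotone: `r_i · ∇ lam_i ≥ 0` in `Ω`. (Being simple eigenvalues of the
smooth matrix field `Df`, the functions `lam i` are automatically smooth in `Ω`.) -/
structure IsMonotoneHyperbolic (Ω : Set State) (f : State → State) (lam : Fin 2 → State → ℝ)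
    (r : Fin 2 → State → State) : Prop where
  isOpen : IsOpen Ω
  smooth_flux : ContDiffOn ℝ ∞ f Ω
  strict : ∀ u ∈ Ω, lam 0 u < lam 1 u
  eigenvector_ne_zero : ∀ i, ∀ u ∈ Ω, r i u ≠ 0
  eigenvector : ∀ i, ∀ u ∈ Ω, fderiv ℝ f u (r i u) = lam i u • r i u
  monotone_field : ∀ i, ∀ u ∈ Ω, 0 ≤ fderiv ℝ (lam i) u (r i u)

/-- `w` is a system of Riemann coordinates near `ubar`: a smooth diffeomorphism `u ↦ w[u]` from an
open neighbourhood of `ubar` in `Ω` onto an open set of the plane, with `∂u/∂w_i = r_i(u)`. -/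
structure IsRiemannCoordinates (Ω : Set State) (r : Fin 2 → State → State) (ubar : State)
    (w : OpenPartialHomeomorph State State) : Prop where
  mem_source : ubar ∈ w.source
  source_subset : w.source ⊆ Ω
  smooth : ContDiffOn ℝ ∞ w w.source
  smooth_symm : ContDiffOn ℝ ∞ w.symm w.target
  partial_eq : ∀ i, ∀ x ∈ w.target, fderiv ℝ w.symm x (Pi.single i 1) = r i (w.symm x)

/-- `v = R_i(σ; u)`: the state `v` is reached at parameter `σ` (of any sign) by the integral curve
of `r_i` that starts at `u`, within the domain of the coordinates `w`. Since `∂u/∂w_i = r_i`,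
the parameter is the jump of `w_i`. -/
def Rarefaction (r : Fin 2 → State → State) (w : OpenPartialHomeomorph State State)
    (i : Fin 2) (σ : ℝ) (u v : State) : Prop :=
  ∃ γ : ℝ → State, γ 0 = u ∧ γ σ = v ∧
    ∀ s ∈ Set.uIcc 0 σ, γ s ∈ w.source ∧
      HasDerivWithinAt γ (r i (γ s)) (Set.uIcc 0 σ) s

/-- `v = S_i(σ; u)`: the state `v` is reached at parameter `σ` (of any sign) by the `i`-th branch
of the Hugoniot locus that starts at `u`, parameterized by the jump of `w_i`. The branch is a
continuous curve `γ` of states that satisfy the Rankine-Hugoniot relations with `u`, with a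
continuous shock speed `V` that equals `lam_i(u)` at the starting point. -/
def Hugoniot (f : State → State) (lam : Fin 2 → State → ℝ)
    (w : OpenPartialHomeomorph State State) (i : Fin 2) (σ : ℝ) (u v : State) : Prop :=
  ∃ (γ : ℝ → State) (V : ℝ → ℝ),
    ContinuousOn γ (Set.uIcc 0 σ) ∧ ContinuousOn V (Set.uIcc 0 σ) ∧
    γ 0 = u ∧ γ σ = v ∧ V 0 = lam i u ∧
    ∀ s ∈ Set.uIcc 0 σ, γ s ∈ w.source ∧ w (γ s) i = w u i + s ∧
      f (γ s) - f u = V s • (γ s - u)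

/-- `v = T_i(σ; u)`: Lax's `i`-th wave curve of a monotone field, which is the rarefaction curve
for `σ ≥ 0` and the Hugoniot locus for `σ ≤ 0`. -/
def Lax (f : State → State) (lam : Fin 2 → State → ℝ) (r : Fin 2 → State → State)
    (w : OpenPartialHomeomorph State State) (i : Fin 2) (σ : ℝ) (u v : State) : Prop :=
  (0 ≤ σ ∧ Rarefaction r w i σ u v) ∨ (σ ≤ 0 ∧ Hugoniot f lam w i σ u v)

/-- The two choices of a wave curve in the variants of the Riemann problem. -/
inductive CurveKind
  | rarefaction
  | lax

/-- `v = U_i(σ; u)`, where `U_i` is `R_i` or `T_i` according to the kind. -/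
def WaveCurve (f : State → State) (lam : Fin 2 → State → ℝ) (r : Fin 2 → State → State)
    (w : OpenPartialHomeomorph State State) :
    CurveKind → Fin 2 → ℝ → State → State → Prop
  | .rarefaction => Rarefaction r w
  | .lax => Lax f lam r w

/-- `ur = U_2(σ₂; U_1(σ₁; ul))`, with curves of the kinds `k₁` and `k₂`. The intermediate state
belongs to the domain of the coordinates, hence to `Ω`. -/
def RiemannSolution (f : State → State) (lam : Fin 2 → State → ℝ) (r : Fin 2 → State → State)
    (w : OpenPartialHomeomorph State State) (k₁ k₂ : CurveKind) (σ₁ σ₂ : ℝ)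
    (ul ur : State) : Prop :=
  ∃ um : State, WaveCurve f lam r w k₁ 0 σ₁ ul um ∧ WaveCurve f lam r w k₂ 1 σ₂ um ur

/-- `U` is an open neighbourhood of `ubar` and `c > 0` is such that each of the four variants of
the Riemann problem between two states of `U` has exactly one solution with strengths in
`(-c, c)`. -/
structure IsRiemannNeighborhood (f : State → State) (lam : Fin 2 → State → ℝ)
    (r : Fin 2 → State → State) (w : OpenPartialHomeomorph State State) (ubar : State)
    (U : Set State) (c : ℝ) : Prop where
  isOpen : IsOpen U
  mem : ubar ∈ U
  subset : U ⊆ w.source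
  pos : 0 < c
  solvable : ∀ k₁ k₂ : CurveKind, ∀ ul ∈ U, ∀ ur ∈ U, ∃! σ : ℝ × ℝ,
    σ.1 ∈ Set.Ioo (-c) c ∧ σ.2 ∈ Set.Ioo (-c) c ∧
      RiemannSolution f lam r w k₁ k₂ σ.1 σ.2 ul ur

/-- The Riemann problem between `ul` and `ur` is solved by classical waves of strengths
`τ 0`, `τ 1` in `(-c, c)`, where `τ i` is within `a` of `s` and the strength of the wave of the
other family is at most `b` in absolute value. -/
def OutgoingWaves (f : State → State) (lam : Fin 2 → State → ℝ) (r : Fin 2 → State → State)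
    (w : OpenPartialHomeomorph State State) (c : ℝ) (i : Fin 2) (ul ur : State)
    (s a b : ℝ) : Prop :=
  ∃ τ : Fin 2 → ℝ, (∀ j, τ j ∈ Set.Ioo (-c) c) ∧
    RiemannSolution f lam r w .lax .lax (τ 0) (τ 1) ul ur ∧
    |τ i - s| ≤ a ∧ ∀ j, j ≠ i → |τ j| ≤ b

end WaveInteraction

open WaveInteraction

/-!
In Riemann coordinates `x = w[u]` the integral curves of `r i` are straight lines parallel to the
`i`-th axis, and the system reads `∂ᵢ F = μᵢ ∂ᵢ u`, where `u x` is the state with coordinates `x`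
and `F x` its flux. So every wave curve of family `i` that starts at `x` is a graph over the
`i`-th axis: a wave of strength `s` adds `s` to the `i`-th coordinate and some `G s x` to the
other one. For a rarefaction `G = 0`. Everything rests on the fact that, for the Hugoniot and
hence for the Lax curves, `G` behaves like `s ^ 3` (`IsCubic`).

* The Hugoniot locus through `x` is singular at `x`, where its two branches cross. Writing the
  point as `x + s (eᵢ + ζ eⱼ)` and dividing the Rankine-Hugoniot relations by `s` (Hadamard's
  lemma) turns them into a smooth equation for `(ζ, V)`, which the implicit function theorem
  solves near `s = 0`, `ζ = 0`, `V = μᵢ` because `μᵢ ≠ μⱼ`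
  (`IsDiagonalSystem.exists_isHugoniotBranch`). A continuous curve of states as in the definition
  of the Hugoniot curve can leave neither a neighbourhood of the starting point nor the smooth
  branch, by the intermediate value theorem (`IsRiemannCoordinates.exists_hugoniot`).
* Differentiating the Rankine-Hugoniot relations along the branch shows that it has a contact of
  second order with the `i`-th axis (`IsHugoniotBranch.deriv_eq_zero`). Mean value inequalities
  then bound `G`, its first and second differences in `s` and its differences in `x`
  (`IsHugoniotBranch.exists_isCubic`). Replacing `G` by `0` for positive strengths preserves these
  bounds (`IsCubic.min_zero`).
* The Riemann problem is a small Lipschitz perturbation of `yₖ - xₖ = σₖ`, hence uniquely solvable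
  with a Lipschitz inverse (`exists_riemannMap_eq`, `riemannMap_stable`).
* After an interaction of two `i`-waves the right state differs from the `i`-th Lax curve of the
  left state only in the other coordinate, by some `d` that is a second difference of `G`, a first
  difference, or a difference in `x`. The outgoing wave of the other family is therefore `O(d)`,
  and it perturbs the `i`-th coordinate by the cube of its own strength, which gives the error
  `O(d ^ 3)` in the strength of the outgoing `i`-wave (`outgoingWaves_of_eq_shift`).
-/

open scoped ContDiff

namespace WaveInteraction

open Set Filter Topology MeasureTheory

/-! ### Hadamard's lemma with parameters -/

theorem hasFDerivAt_integral_zero_one {P G : Type*} [NormedAddCommGroup P] [NormedSpace ℝ P]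
    [ProperSpace P] [NormedAddCommGroup G] [NormedSpace ℝ G] {f : P × ℝ → G}
    (hf : ContDiff ℝ 1 f) (p : P) :
    HasFDerivAt (fun q => ∫ t in (0 : ℝ)..1, f (q, t))
      (∫ t in (0 : ℝ)..1, (fderiv ℝ f (p, t)).comp (ContinuousLinearMap.inl ℝ P ℝ)) p := by
  have hc : Continuous fun q : P × ℝ =>
      (fderiv ℝ f q).comp (ContinuousLinearMap.inl ℝ P ℝ) :=
    (hf.continuous_fderiv one_ne_zero).clm_comp continuous_const
  obtain ⟨K, hK⟩ := ((isCompact_closedBall p 1).prod (isCompact_Icc (a := (0 : ℝ)) (b := 1))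
    ).exists_bound_of_continuousOn hc.continuousOn
  refine intervalIntegral.hasFDerivAt_integral_of_dominated_of_fderiv_le
    (F' := fun q t => (fderiv ℝ f (q, t)).comp (ContinuousLinearMap.inl ℝ P ℝ))
    (bound := fun _ => K) (Metric.closedBall_mem_nhds p one_pos) ?_ ?_ ?_ ?_ ?_ ?_
  · exact Eventually.of_forall fun q =>
      (hf.continuous.comp (by fun_prop : Continuous fun t : ℝ => (q, t))).aestronglyMeasurable
  · exact (hf.continuous.comp (by fun_prop : Continuous fun t : ℝ => (p, t))).intervalIntegrable _ _
  · exact (hc.comp (by fun_prop : Continuous fun t : ℝ => (p, t))).aestronglyMeasurable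
  · refine Eventually.of_forall fun t ht q hq => hK (q, t) ⟨hq, ?_⟩
    rw [uIoc_of_le zero_le_one] at ht
    exact Ioc_subset_Icc_self ht
  · exact intervalIntegrable_const
  · refine Eventually.of_forall fun t _ q _ => ?_
    exact HasFDerivAt.comp (f := fun q : P => (q, t)) q
      (hf.differentiable one_ne_zero (q, t)).hasFDerivAt (hasFDerivAt_prodMk_left q t)

/-- The case of finite smoothness, by induction on `n` for all target spaces `G` at once, since the
derivative takes its values in `P →L[ℝ] G`. -/
theorem contDiff_nat_integral_zero_one {P : Type} [NormedAddCommGroup P] [NormedSpace ℝ P]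
    [ProperSpace P] (n : ℕ) : ∀ {G : Type} [NormedAddCommGroup G] [NormedSpace ℝ G]
    {f : P × ℝ → G}, ContDiff ℝ n f → ContDiff ℝ n fun p => ∫ t in (0 : ℝ)..1, f (p, t) := by
  induction n with
  | zero =>
    intro G _ _ f hf
    rw [Nat.cast_zero, contDiff_zero] at hf ⊢
    exact intervalIntegral.continuous_parametric_intervalIntegral_of_continuous'
      (f := fun p t => f (p, t)) hf 0 1
  | succ n ih =>
    intro G _ _ f hf
    have h1 : ContDiff ℝ 1 f := hf.of_le (by norm_cast; omega)
    have hd := fun p => hasFDerivAt_integral_zero_one h1 p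
    rw [Nat.cast_succ, contDiff_succ_iff_fderiv]
    refine ⟨fun p => (hd p).differentiableAt, by simp, ?_⟩
    rw [show fderiv ℝ (fun p => ∫ t in (0 : ℝ)..1, f (p, t)) = _ from funext fun p => (hd p).fderiv]
    refine ih (f := fun q => (fderiv ℝ f q).comp (ContinuousLinearMap.inl ℝ P ℝ)) ?_
    exact (hf.fderiv_right (m := n) (by norm_cast)).clm_comp contDiff_const

theorem contDiff_integral_zero_one {P G : Type} [NormedAddCommGroup P] [NormedSpace ℝ P]
    [ProperSpace P] [NormedAddCommGroup G] [NormedSpace ℝ G] {f : P × ℝ → G}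
    (hf : ContDiff ℝ ∞ f) : ContDiff ℝ ∞ fun p => ∫ t in (0 : ℝ)..1, f (p, t) :=
  contDiff_infty.2 fun n => contDiff_nat_integral_zero_one n (contDiff_infty.1 hf n)

/-- The average of the derivative of `g` over the segment from `p.1` to `p.1 + p.2`. -/
noncomputable def avgDeriv (g : State → State) (p : State × State) : State →L[ℝ] State :=
  ∫ t in (0 : ℝ)..1, fderiv ℝ g (p.1 + t • p.2)

theorem contDiff_avgDeriv {g : State → State} (hg : ContDiff ℝ ∞ g) :
    ContDiff ℝ ∞ (avgDeriv g) := by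
  refine contDiff_integral_zero_one
    (f := fun q : (State × State) × ℝ => fderiv ℝ g (q.1.1 + q.2 • q.1.2)) ?_
  exact (hg.fderiv_right (m := ∞) (by simp)).comp (by fun_prop)

theorem avgDeriv_zero (g : State → State) (x : State) : avgDeriv g (x, 0) = fderiv ℝ g x := by
  simp [avgDeriv]

/-- Hadamard's lemma: the increments of `g` factor through a smooth family of linear maps. -/
theorem avgDeriv_apply {g : State → State} (hg : ContDiff ℝ ∞ g) (x h : State) :
    avgDeriv g (x, h) h = g (x + h) - g x := by
  have hc : Continuous fun t : ℝ => fderiv ℝ g (x + t • h) :=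
    (hg.continuous_fderiv (by simp)).comp (by fun_prop)
  have hd : ∀ t ∈ uIcc (0 : ℝ) 1,
      HasDerivAt (fun t : ℝ => g (x + t • h)) (fderiv ℝ g (x + t • h) h) t := by
    intro t _
    have h1 : HasDerivAt (fun t : ℝ => x + t • h) h t := by
      simpa using ((hasDerivAt_id t).smul_const h).const_add x
    exact (hg.differentiable (by simp) _).hasFDerivAt.comp_hasDerivAt t h1
  have := intervalIntegral.integral_eq_sub_of_hasDerivAt hd
    ((hc.clm_apply continuous_const).intervalIntegrable _ _)
  simp only [avgDeriv]
  rw [ContinuousLinearMap.intervalIntegral_apply (hc.intervalIntegrable _ _), this]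
  simp

/-! ### Functions that vanish to third order in the wave strength -/

theorem abs_sub_le_of_abs_deriv_le {h h' : ℝ → ℝ} {a b M : ℝ}
    (hd : ∀ t ∈ uIcc a b, HasDerivAt h (h' t) t) (hM : ∀ t ∈ uIcc a b, |h' t| ≤ M) :
    |h b - h a| ≤ M * |b - a| := by
  have := (convex_uIcc a b).norm_image_sub_le_of_norm_hasDerivWithin_le (C := M)
    (fun t ht => (hd t ht).hasDerivWithinAt) hM left_mem_uIcc right_mem_uIcc
  simpa [Real.norm_eq_abs] using this

/-- `G s x` stands for the change of one Riemann coordinate along a wave curve of the other family that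
starts at the state with coordinates `x` and has strength `s`. The bounds say that `G`, its first and
its second differences in `s` are as small as those of `s ^ 3`, uniformly near `xbar`. The Lipschitz
constant in `x` is only required to be `O(s ^ 2)`, which suffices for the interaction estimates. -/
structure IsCubic (G : ℝ → State → ℝ) (xbar : State) (ρ K : ℝ) : Prop where
  pos : 0 < ρ
  nonneg : 0 ≤ K
  bound : ∀ s, |s| < ρ → ∀ x ∈ Metric.ball xbar ρ, |G s x| ≤ K * |s| ^ 3
  lipschitz : ∀ s, |s| < ρ → ∀ x ∈ Metric.ball xbar ρ, ∀ y ∈ Metric.ball xbar ρ,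
    |G s x - G s y| ≤ K * |s| ^ 2 * dist x y
  sub_bound : ∀ s t, |s| < ρ → |t| < ρ → ∀ x ∈ Metric.ball xbar ρ,
    |G s x - G t x| ≤ K * |s - t| * (|s| + |t|) ^ 2
  second_bound : ∀ s t, |s| + |t| < ρ → ∀ x ∈ Metric.ball xbar ρ,
    |G (s + t) x - G s x - G t x| ≤ K * |s| * |t| * (|s| + |t|)

theorem abs_le_of_mem_uIcc_zero {t s : ℝ} (h : t ∈ uIcc 0 s) : |t| ≤ |s| := by
  simpa using abs_sub_left_of_mem_uIcc h

/-- A function with a Lipschitz second derivative in `s` is cubic if it vanishes at `s = 0` together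
with its first and second derivatives. -/
theorem isCubic_of_hasDerivAt {z z' z'' : ℝ → State → ℝ} {xbar : State} {ρ K : ℝ} (hρ : 0 < ρ)
    (hK : 0 ≤ K)
    (hz : ∀ s, |s| < ρ → ∀ x ∈ Metric.ball xbar ρ, HasDerivAt (fun t => z t x) (z' s x) s)
    (hz' : ∀ s, |s| < ρ → ∀ x ∈ Metric.ball xbar ρ, HasDerivAt (fun t => z' t x) (z'' s x) s)
    (h0 : ∀ x ∈ Metric.ball xbar ρ, z 0 x = 0) (h0' : ∀ x ∈ Metric.ball xbar ρ, z' 0 x = 0)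
    (hs : ∀ s, |s| < ρ → ∀ x ∈ Metric.ball xbar ρ, |z'' s x| ≤ K * |s|)
    (hx : ∀ s, |s| < ρ → ∀ x ∈ Metric.ball xbar ρ, ∀ y ∈ Metric.ball xbar ρ,
      |z'' s x - z'' s y| ≤ K * dist x y) :
    IsCubic z xbar ρ K := by
  have hlt : ∀ {s t : ℝ}, |s| < ρ → t ∈ uIcc 0 s → |t| < ρ := fun h h' =>
    (abs_le_of_mem_uIcc_zero h').trans_lt h
  have b1 : ∀ s, |s| < ρ → ∀ x ∈ Metric.ball xbar ρ, |z' s x| ≤ K * |s| ^ 2 := by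
    intro s h x hx
    have := abs_sub_le_of_abs_deriv_le (M := K * |s|) (fun t ht => hz' t (hlt h ht) x hx)
      (fun t ht => (hs t (hlt h ht) x hx).trans
        (mul_le_mul_of_nonneg_left (abs_le_of_mem_uIcc_zero ht) hK))
    rw [h0' x hx, sub_zero, sub_zero] at this
    linarith
  have hmid : ∀ {s t r : ℝ}, r ∈ uIcc s t → |r| ≤ |s| + |t| := by
    intro s t r hr
    rcases mem_uIcc.1 hr with h | h <;> apply abs_le.2 <;>
      constructor <;> cases abs_cases s <;> cases abs_cases t <;> linarith
  have hmax : ∀ {s t r : ℝ}, |s| < ρ → |t| < ρ → r ∈ uIcc s t → |r| < ρ := by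
    intro s t r h1 h2 hr
    rw [abs_lt] at h1 h2 ⊢
    rcases mem_uIcc.1 hr with h | h <;> constructor <;> linarith
  refine ⟨hρ, hK, ?_, ?_, ?_, ?_⟩
  · intro s h x hx
    have := abs_sub_le_of_abs_deriv_le (M := K * |s| ^ 2) (fun t ht => hz t (hlt h ht) x hx)
      (fun t ht => (b1 t (hlt h ht) x hx).trans (by
        have := abs_le_of_mem_uIcc_zero ht
        gcongr))
    rw [h0 x hx, sub_zero, sub_zero] at this
    linarith
  · intro s h x hx' y hy
    have l1 : ∀ r, |r| < ρ → |z' r x - z' r y| ≤ K * dist x y * |r| := by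
      intro r hr
      have := abs_sub_le_of_abs_deriv_le (h := fun t => z' t x - z' t y) (M := K * dist x y)
        (fun t ht => (hz' t (hlt hr ht) x hx').sub (hz' t (hlt hr ht) y hy))
        (fun t ht => hx t (hlt hr ht) x hx' y hy)
      simpa [h0' x hx', h0' y hy] using this
    have := abs_sub_le_of_abs_deriv_le (h := fun t => z t x - z t y) (M := K * dist x y * |s|)
        (fun t ht => (hz t (hlt h ht) x hx').sub (hz t (hlt h ht) y hy))
        (fun t ht => (l1 t (hlt h ht)).trans (by
          have := abs_le_of_mem_uIcc_zero ht
          gcongr))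
    simp only [h0 x hx', h0 y hy, sub_zero] at this
    linarith
  · intro s t hs' ht' x hx'
    have := abs_sub_le_of_abs_deriv_le (a := t) (b := s) (M := K * (|t| + |s|) ^ 2)
      (fun r hr => hz r (hmax ht' hs' hr) x hx')
      (fun r hr => (b1 r (hmax ht' hs' hr) x hx').trans (by
        have := hmid hr
        gcongr))
    rw [add_comm |t|] at this
    linarith
  · intro s t hst x hx'
    have hadd : ∀ {r : ℝ}, |r| ≤ |t| → |s + r| ≤ |s| + |t| := fun hr =>
      (abs_add_le _ _).trans (by linarith)
    have c1 : ∀ r, |r| ≤ |t| → |z' (s + r) x - z' r x| ≤ K * (|s| + |t|) * |s| := by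
      intro r hr
      have e : ∀ q ∈ uIcc r (s + r), |q| ≤ |s| + |t| := by
        intro q hq
        have h1 := hadd hr
        have h2 : |r| ≤ |s| + |t| := hr.trans (by linarith [abs_nonneg s])
        rw [abs_le] at h1 h2 ⊢
        rcases mem_uIcc.1 hq with h | h <;> constructor <;> linarith
      have := abs_sub_le_of_abs_deriv_le (a := r) (b := s + r) (M := K * (|s| + |t|))
        (fun q hq => hz' q ((e q hq).trans_lt hst) x hx')
        (fun q hq => (hs q ((e q hq).trans_lt hst) x hx').trans
          (mul_le_mul_of_nonneg_left (e q hq) hK))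
      simpa using this
    have := abs_sub_le_of_abs_deriv_le (h := fun r => z (s + r) x - z r x) (a := 0) (b := t)
      (M := K * (|s| + |t|) * |s|)
      (fun r hr => by
        have hr' := abs_le_of_mem_uIcc_zero hr
        refine HasDerivAt.sub ?_ (hz r (by linarith [abs_nonneg s]) x hx')
        exact (hz (s + r) ((hadd hr').trans_lt hst) x hx').comp_const_add s r)
      (fun r hr => c1 r (abs_le_of_mem_uIcc_zero hr))
    simp only [h0 x hx', sub_zero, add_zero] at this
    calc |z (s + t) x - z s x - z t x| = |z (s + t) x - z t x - z s x| := by congr 1; ring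
      _ ≤ _ := this
      _ = _ := by ring

theorem isCubic_zero {xbar : State} {ρ K : ℝ} (hρ : 0 < ρ) (hK : 0 ≤ K) :
    IsCubic (fun _ _ => 0) xbar ρ K := by
  refine ⟨hρ, hK, ?_, ?_, ?_, ?_⟩ <;> intros <;> simp <;> positivity

theorem IsCubic.mono {G : ℝ → State → ℝ} {xbar : State} {ρ ρ' K K' : ℝ}
    (h : IsCubic G xbar ρ K) (hρ' : 0 < ρ') (hρ : ρ' ≤ ρ) (hK : K ≤ K') :
    IsCubic G xbar ρ' K' := by
  have hb := Metric.ball_subset_ball (x := xbar) hρ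
  refine ⟨hρ', h.nonneg.trans hK, ?_, ?_, ?_, ?_⟩
  · exact fun s hs x hx => (h.bound s (hs.trans_le hρ) x (hb hx)).trans (by gcongr)
  · exact fun s hs x hx y hy =>
      (h.lipschitz s (hs.trans_le hρ) x (hb hx) y (hb hy)).trans (by gcongr)
  · exact fun s t hs ht x hx =>
      (h.sub_bound s t (hs.trans_le hρ) (ht.trans_le hρ) x (hb hx)).trans (by gcongr)
  · exact fun s t hs x hx =>
      (h.second_bound s t (hs.trans_le hρ) x (hb hx)).trans (by gcongr)

theorem IsCubic.apply_zero {G : ℝ → State → ℝ} {xbar : State} {ρ K : ℝ} (h : IsCubic G xbar ρ K)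
    {x : State} (hx : x ∈ Metric.ball xbar ρ) : G 0 x = 0 := by
  simpa using h.bound 0 (by simpa using h.pos) x hx

/-- Gluing a Hugoniot curve (for negative strengths) to a rarefaction curve preserves the cubic
bounds: both curves have a contact of second order. -/
theorem IsCubic.min_zero {G : ℝ → State → ℝ} {xbar : State} {ρ K : ℝ} (h : IsCubic G xbar ρ K) :
    IsCubic (fun s => G (min s 0)) xbar ρ (4 * K) := by
  have hK := h.nonneg
  have hm : ∀ s : ℝ, |min s 0| ≤ |s| := fun s => by
    rcases le_total s 0 with h | h <;> simp [h]
  have hl : ∀ s t : ℝ, |min s 0 - min t 0| ≤ |s - t| := fun s t => by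
    simpa using abs_min_sub_min_le_max s 0 t 0
  have hK4 : K ≤ 4 * K := by linarith
  refine ⟨h.pos, by positivity, ?_, ?_, ?_, ?_⟩
  · intro s hs x hx
    refine (h.bound _ ((hm s).trans_lt hs) x hx).trans ?_
    have := hm s
    gcongr
  · intro s hs x hx y hy
    refine (h.lipschitz _ ((hm s).trans_lt hs) x hx y hy).trans ?_
    have := hm s
    gcongr
  · intro s t hs ht x hx
    refine (h.sub_bound _ _ ((hm s).trans_lt hs) ((hm t).trans_lt ht) x hx).trans ?_
    have := hm s
    have := hm t
    have := hl s t
    gcongr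
  · -- the case of two nonpositive strengths is inherited, and the sum of a nonpositive `a` and of a
    -- nonnegative `b` reduces to a first difference
    have mixed : ∀ a b : ℝ, a ≤ 0 → 0 ≤ b → |a| + |b| < ρ → ∀ x ∈ Metric.ball xbar ρ,
        |G (min (a + b) 0) x - G a x| ≤ 4 * K * |a| * |b| * (|a| + |b|) := by
      intro a b ha hb hab x hx
      have hm1 : |min (a + b) 0| ≤ |a| := by
        rw [abs_of_nonpos (min_le_right _ _), abs_of_nonpos ha]
        have : a ≤ min (a + b) 0 := le_min (by linarith) ha
        linarith
      have haρ : |a| < ρ := by linarith [abs_nonneg b]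
      rcases le_total (a + b) 0 with hs | hs
      · have hm1' : |a + b| ≤ |a| := by rwa [min_eq_left hs] at hm1
        rw [min_eq_left hs]
        refine (h.sub_bound (a + b) a (hm1'.trans_lt haρ) haρ x hx).trans ?_
        calc K * |a + b - a| * (|a + b| + |a|) ^ 2 = K * |b| * (|a + b| + |a|) ^ 2 := by
              rw [add_sub_cancel_left]
          _ ≤ K * |b| * (|a| + |a|) ^ 2 := by gcongr
          _ = 4 * K * |a| * |b| * |a| := by ring
          _ ≤ 4 * K * |a| * |b| * (|a| + |b|) := by gcongr; linarith [abs_nonneg b]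
      · rw [min_eq_right hs, h.apply_zero hx, zero_sub, abs_neg]
        refine (h.bound a haρ x hx).trans ?_
        have hab' : |a| ≤ |b| := by
          rw [abs_of_nonneg hb, abs_of_nonpos ha]; linarith
        calc K * |a| ^ 3 = K * |a| * |a| * |a| := by ring
          _ ≤ 4 * K * |a| * |b| * (|a| + |b|) := by gcongr; linarith [abs_nonneg b]
    intro s t hst x hx
    rcases le_total s 0 with hs | hs <;> rcases le_total t 0 with ht | ht
    · have := (h.second_bound s t hst x hx).trans
        (by gcongr : _ ≤ 4 * K * |s| * |t| * (|s| + |t|))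
      simpa only [min_eq_left hs, min_eq_left ht, min_eq_left (add_nonpos hs ht)] using this
    · simpa [min_eq_left hs, min_eq_right ht, h.apply_zero hx] using mixed s t hs ht hst x hx
    · have := mixed t s ht hs (by linarith) x hx
      rw [add_comm t s] at this
      simp only [min_eq_left ht, min_eq_right hs, h.apply_zero hx, sub_zero]
      linarith
    · simp only [min_eq_right hs, min_eq_right ht, min_eq_right (add_nonneg hs ht),
        h.apply_zero hx]
      simp
      positivity

/-! ### The Hugoniot locus in Riemann coordinates -/

section

/-- The determinant of two vectors of the plane. -/
def wedge (a b : State) : ℝ := a 0 * b 1 - a 1 * b 0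

theorem wedge_self (a : State) : wedge a a = 0 := by simp only [wedge]; ring

theorem wedge_add_right (a b c : State) : wedge a (b + c) = wedge a b + wedge a c := by
  simp only [wedge, Pi.add_apply]; ring

theorem wedge_sub_right (a b c : State) : wedge a (b - c) = wedge a b - wedge a c := by
  simp only [wedge, Pi.sub_apply]; ring

theorem wedge_smul_right (t : ℝ) (a b : State) : wedge a (t • b) = t * wedge a b := by
  simp only [wedge, Pi.smul_apply, smul_eq_mul]; ring

theorem wedge_zero_right (a : State) : wedge a 0 = 0 := by simp [wedge]

theorem wedge_comm (a b : State) : wedge a b = -wedge b a := by simp only [wedge]; ring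

/-- A hyperbolic system written in Riemann coordinates `x` near `xbar`: `u x` is the state with
coordinates `x`, `F x` is the flux at that state, and the `k`-th partial derivatives of `F` and `u`
are proportional with factor `μ k x`, the `k`-th characteristic speed. -/
structure IsDiagonalSystem (u F : State → State) (μ : Fin 2 → State → ℝ) (xbar : State) (R : ℝ) :
    Prop where
  pos : 0 < R
  smooth_u : ContDiff ℝ ∞ u
  smooth_F : ContDiff ℝ ∞ F
  partial_F : ∀ k, ∀ x ∈ Metric.ball xbar R,
    fderiv ℝ F x (Pi.single k 1) = μ k x • fderiv ℝ u x (Pi.single k 1)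
  wedge_ne_zero : ∀ x ∈ Metric.ball xbar R,
    wedge (fderiv ℝ u x (Pi.single 0 1)) (fderiv ℝ u x (Pi.single 1 1)) ≠ 0
  strict : ∀ x ∈ Metric.ball xbar R, μ 0 x < μ 1 x

/-- The point with coordinates `x i + s` and `x j + z`, for distinct `i` and `j`. -/
def shift (i j : Fin 2) (x : State) (s z : ℝ) : State :=
  x + (s • Pi.single i 1 + z • Pi.single j 1)

/-- The Rankine-Hugoniot relations between `x` and `shift i j x s (s * ζ)` for a shock of speed
`V`, divided by `s`. The argument is `((s, x), (ζ, V))`. Division by `s` removes the singularity of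
the Hugoniot locus at its starting point. -/
noncomputable def rankineHugoniot (u F : State → State) (i j : Fin 2)
    (q : (ℝ × State) × (ℝ × ℝ)) : State :=
  avgDeriv F (q.1.2, q.1.1 • (Pi.single i 1 + q.2.1 • Pi.single j 1))
      (Pi.single i 1 + q.2.1 • Pi.single j 1) -
    q.2.2 • avgDeriv u (q.1.2, q.1.1 • (Pi.single i 1 + q.2.1 • Pi.single j 1))
      (Pi.single i 1 + q.2.1 • Pi.single j 1)

variable {u F : State → State} {μ : Fin 2 → State → ℝ} {xbar : State} {R : ℝ} {i j : Fin 2}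

theorem IsDiagonalSystem.wedge_ne (h : IsDiagonalSystem u F μ xbar R) (hij : i ≠ j) {x : State}
    (hx : x ∈ Metric.ball xbar R) :
    wedge (fderiv ℝ u x (Pi.single i 1)) (fderiv ℝ u x (Pi.single j 1)) ≠ 0 := by
  have := h.wedge_ne_zero x hx
  fin_cases i <;> fin_cases j
  · exact absurd rfl hij
  · exact this
  · rw [wedge_comm, neg_ne_zero]; exact this
  · exact absurd rfl hij

theorem IsDiagonalSystem.speed_ne (h : IsDiagonalSystem u F μ xbar R) (hij : i ≠ j) {x : State}
    (hx : x ∈ Metric.ball xbar R) : μ j x - μ i x ≠ 0 := by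
  have := h.strict x hx
  rw [sub_ne_zero]
  fin_cases i <;> fin_cases j
  · exact absurd rfl hij
  · exact this.ne'
  · exact this.ne
  · exact absurd rfl hij

theorem IsDiagonalSystem.contDiff_rankineHugoniot (h : IsDiagonalSystem u F μ xbar R)
    (i j : Fin 2) : ContDiff ℝ ∞ (rankineHugoniot u F i j) := by
  have hd : ContDiff ℝ ∞ fun q : (ℝ × State) × (ℝ × ℝ) =>
      (Pi.single i 1 + q.2.1 • Pi.single j 1 : State) := by fun_prop
  have hp : ContDiff ℝ ∞ fun q : (ℝ × State) × (ℝ × ℝ) =>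
      (q.1.2, q.1.1 • (Pi.single i 1 + q.2.1 • Pi.single j 1 : State)) := by fun_prop
  exact (((contDiff_avgDeriv h.smooth_F).comp hp).clm_apply hd).sub
    ((contDiff_snd.comp contDiff_snd).smul
      (((contDiff_avgDeriv h.smooth_u).comp hp).clm_apply hd))

theorem IsDiagonalSystem.smul_rankineHugoniot (h : IsDiagonalSystem u F μ xbar R)
    (i j : Fin 2) (s ζ V : ℝ) (x : State) :
    s • rankineHugoniot u F i j ((s, x), (ζ, V)) =
      F (shift i j x s (s * ζ)) - F x - V • (u (shift i j x s (s * ζ)) - u x) := by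
  have e : shift i j x s (s * ζ) = x + s • (Pi.single i 1 + ζ • Pi.single j 1) := by
    simp only [shift, smul_add, smul_smul]
  rw [e, ← avgDeriv_apply h.smooth_F, ← avgDeriv_apply h.smooth_u]
  simp only [rankineHugoniot, map_smul, smul_sub]
  rw [smul_comm s V]

theorem IsDiagonalSystem.rankineHugoniot_zero (h : IsDiagonalSystem u F μ xbar R)
    (i j : Fin 2) (ζ V : ℝ) {x : State} (hx : x ∈ Metric.ball xbar R) :
    rankineHugoniot u F i j ((0, x), (ζ, V)) =
      (μ i x - V) • fderiv ℝ u x (Pi.single i 1) +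
        (ζ * (μ j x - V)) • fderiv ℝ u x (Pi.single j 1) := by
  simp only [rankineHugoniot, zero_smul, avgDeriv_zero, map_add, map_smul, h.partial_F _ x hx]
  module

theorem IsDiagonalSystem.eq_zero_of_smul_add_smul (h : IsDiagonalSystem u F μ xbar R)
    (hij : i ≠ j) {x : State} (hx : x ∈ Metric.ball xbar R) {a b : ℝ}
    (hab : a • fderiv ℝ u x (Pi.single i 1) + b • fderiv ℝ u x (Pi.single j 1) = 0) :
    a = 0 ∧ b = 0 := by
  have h1 := congrArg (wedge (fderiv ℝ u x (Pi.single i 1))) hab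
  have h2 := congrArg (wedge (fderiv ℝ u x (Pi.single j 1))) hab
  simp only [wedge_add_right, wedge_smul_right, wedge_self, wedge_zero_right, mul_zero, zero_add,
    add_zero, mul_eq_zero, h.wedge_ne hij hx, h.wedge_ne hij.symm hx, or_false] at h1 h2
  exact ⟨h2, h1⟩

theorem IsDiagonalSystem.fderiv_rankineHugoniot_apply (h : IsDiagonalSystem u F μ xbar R)
    (i j : Fin 2) (a b : ℝ) :
    fderiv ℝ (rankineHugoniot u F i j) ((0, xbar), (0, μ i xbar)) ((0, 0), (a, b)) =
      (-b) • fderiv ℝ u xbar (Pi.single i 1) +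
        (a * (μ j xbar - μ i xbar)) • fderiv ℝ u xbar (Pi.single j 1) := by
  have hx : xbar ∈ Metric.ball xbar R := Metric.mem_ball_self h.pos
  have hl : HasDerivAt (fun t : ℝ => (((0, xbar), (t * a, μ i xbar + t * b)) :
      (ℝ × State) × (ℝ × ℝ))) ((0, 0), (a, b)) 0 := by
    refine (hasDerivAt_const _ _).prodMk (HasDerivAt.prodMk ?_ ?_)
    · simpa using (hasDerivAt_id (0 : ℝ)).mul_const a
    · simpa using ((hasDerivAt_id (0 : ℝ)).mul_const b).const_add (μ i xbar)
  have h1 := HasFDerivAt.comp_hasDerivAt_of_eq (0 : ℝ)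
    (((h.contDiff_rankineHugoniot i j).differentiable (by simp)
      ((0, xbar), (0, μ i xbar))).hasFDerivAt) hl (by simp)
  have h2 : HasDerivAt (fun t : ℝ => (-(t * b)) • fderiv ℝ u xbar (Pi.single i 1) +
      ((t * a) * (μ j xbar - μ i xbar - t * b)) • fderiv ℝ u xbar (Pi.single j 1))
      ((-b) • fderiv ℝ u xbar (Pi.single i 1) +
        (a * (μ j xbar - μ i xbar)) • fderiv ℝ u xbar (Pi.single j 1)) 0 := by
    have e1 : HasDerivAt (fun t : ℝ => t * b) b 0 := by
      simpa using (hasDerivAt_id (0 : ℝ)).mul_const b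
    have e2 : HasDerivAt (fun t : ℝ => t * a) a 0 := by
      simpa using (hasDerivAt_id (0 : ℝ)).mul_const a
    refine (e1.neg.smul_const _).add (HasDerivAt.smul_const ?_ _)
    simpa using! e2.mul (e1.const_sub (μ j xbar - μ i xbar))
  refine h1.unique (h2.congr_of_eventuallyEq (Eventually.of_forall fun t => ?_))
  simp only [Function.comp_apply, h.rankineHugoniot_zero i j _ _ hx]
  congr 2 <;> ring

/-- The derivative of the reduced Rankine-Hugoniot relations with respect to `(ζ, V)` is invertible,
because the eigenvectors are independent and the characteristic speeds differ. -/
theorem IsDiagonalSystem.isInvertible (h : IsDiagonalSystem u F μ xbar R) (hij : i ≠ j) :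
    (fderiv ℝ (rankineHugoniot u F i j) ((0, xbar), (0, μ i xbar)) ∘L
      .inr ℝ (ℝ × State) (ℝ × ℝ)).IsInvertible := by
  set L := fderiv ℝ (rankineHugoniot u F i j) ((0, xbar), (0, μ i xbar)) ∘L
      .inr ℝ (ℝ × State) (ℝ × ℝ)
  have hx : xbar ∈ Metric.ball xbar R := Metric.mem_ball_self h.pos
  have hinj : Function.Injective (L : (ℝ × ℝ) →ₗ[ℝ] State) := by
    rw [← LinearMap.ker_eq_bot, LinearMap.ker_eq_bot']
    rintro ⟨a, b⟩ hab
    obtain ⟨h1, h2⟩ := h.eq_zero_of_smul_add_smul hij hx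
      ((h.fderiv_rankineHugoniot_apply i j a b).symm.trans hab)
    have := h.speed_ne hij hx
    simp_all
  refine ⟨(LinearMap.linearEquivOfInjective (L : (ℝ × ℝ) →ₗ[ℝ] State) hinj
    (by simp)).toContinuousLinearEquiv, ?_⟩
  ext <;> simp

/-- States on the Hugoniot locus whose shock speed is close to the `i`-th characteristic speed lie
in a thin cone around the `i`-th coordinate direction. -/
theorem IsDiagonalSystem.exists_cone (h : IsDiagonalSystem u F μ xbar R) (hij : i ≠ j) {θ : ℝ}
    (hθ : 0 < θ) : ∃ ε > 0, ∀ (s z V : ℝ) (x : State), |s| ≤ ε → |z| ≤ ε → |V - μ i xbar| ≤ ε →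
      dist x xbar ≤ ε → F (shift i j x s z) - F x = V • (u (shift i j x s z) - u x) →
      |z| ≤ θ * |s| := by
  have hx : xbar ∈ Metric.ball xbar R := Metric.mem_ball_self h.pos
  set A : Fin 2 → State × State × ℝ → State := fun k q =>
    avgDeriv F (q.1, q.2.1) (Pi.single k 1) - q.2.2 • avgDeriv u (q.1, q.2.1) (Pi.single k 1)
    with hA
  have hcont : ∀ k, Continuous (A k) := by
    intro k
    have c1 := (contDiff_avgDeriv h.smooth_F).continuous
    have c2 := (contDiff_avgDeriv h.smooth_u).continuous
    have hp : Continuous fun q : State × State × ℝ => (q.1, q.2.1) := by fun_prop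
    exact ((c1.comp hp).clm_apply continuous_const).sub
      ((continuous_snd.comp continuous_snd).smul ((c2.comp hp).clm_apply continuous_const))
  have hA0 : ∀ k, A k (xbar, 0, μ i xbar) =
      (μ k xbar - μ i xbar) • fderiv ℝ u xbar (Pi.single k 1) := by
    intro k
    simp only [hA, avgDeriv_zero, h.partial_F _ _ hx, sub_smul]
  have hj : A j (xbar, 0, μ i xbar) ≠ 0 := by
    rw [hA0]
    refine smul_ne_zero (h.speed_ne hij hx) fun h0 => h.wedge_ne hij hx ?_
    rw [h0, wedge_zero_right]
  set β := ‖A j (xbar, 0, μ i xbar)‖ / 2 with hβ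
  have hβ0 : 0 < β := by positivity
  have ev : ∀ᶠ q in 𝓝 ((xbar, 0, μ i xbar) : State × State × ℝ),
      ‖A i q‖ < θ * β ∧ β < ‖A j q‖ := by
    refine ((hcont i).norm.continuousAt.eventually_lt continuousAt_const ?_).and
      (continuousAt_const.eventually_lt (hcont j).norm.continuousAt ?_)
    · rw [hA0]; simp; positivity
    · rw [hβ]; linarith [norm_pos_iff.2 hj]
  obtain ⟨η, hη, hball⟩ := Metric.eventually_nhds_iff_ball.1 ev
  refine ⟨η / 3, by positivity, fun s z V x hs hz hV hxx hRH => ?_⟩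
  set d : State := s • Pi.single i 1 + z • Pi.single j 1 with hd
  have hdn : ‖d‖ ≤ |s| + |z| := by
    refine (norm_add_le _ _).trans (by simp [norm_smul, Pi.norm_single])
  obtain ⟨b1, b2⟩ := hball (x, d, V) (by
    rw [Metric.mem_ball, Prod.dist_eq, Prod.dist_eq, max_lt_iff, max_lt_iff, dist_zero_right,
      Real.dist_eq]
    refine ⟨?_, ?_, ?_⟩ <;> simp only <;> linarith)
  have key : s • A i (x, d, V) + z • A j (x, d, V) = 0 := by
    have e : F (shift i j x s z) - F x - V • (u (shift i j x s z) - u x) = 0 :=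
      sub_eq_zero.2 hRH
    rw [shift, ← hd, ← avgDeriv_apply h.smooth_F, ← avgDeriv_apply h.smooth_u] at e
    rw [← e]
    simp only [hA]
    conv_rhs => rw [show avgDeriv F (x, d) d = s • avgDeriv F (x, d) (Pi.single i 1) +
      z • avgDeriv F (x, d) (Pi.single j 1) by rw [← map_smul, ← map_smul, ← map_add],
      show avgDeriv u (x, d) d = s • avgDeriv u (x, d) (Pi.single i 1) +
      z • avgDeriv u (x, d) (Pi.single j 1) by rw [← map_smul, ← map_smul, ← map_add]]
    module
  have hn : |z| * ‖A j (x, d, V)‖ = |s| * ‖A i (x, d, V)‖ := by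
    rw [← Real.norm_eq_abs, ← Real.norm_eq_abs, ← norm_smul, ← norm_smul,
      eq_neg_of_add_eq_zero_right key, norm_neg]
  have h3 : |z| * β ≤ θ * |s| * β := by
    calc |z| * β ≤ |z| * ‖A j (x, d, V)‖ := by gcongr
      _ = |s| * ‖A i (x, d, V)‖ := hn
      _ ≤ |s| * (θ * β) := by gcongr
      _ = _ := by ring
  exact le_of_mul_le_mul_right h3 hβ0

/-- The `i`-th branch of the Hugoniot locus through `x`, for `x` near `xbar`: it consists of the
points `shift i j x s (z (s, x))`, reached by shocks of speed `V (s, x)`. The branch is of class `C³`, and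
up to the distance `ε` it contains every state that is connected to `x` by a shock of speed close to
the `i`-th characteristic speed. For `s = 0` the Rankine-Hugoniot relations are void, so they do not
determine the speed there. -/
structure IsHugoniotBranch (u F : State → State) (μ : Fin 2 → State → ℝ) (xbar : State)
    (i j : Fin 2) (z V : ℝ × State → ℝ) (ρ ε : ℝ) : Prop where
  pos : 0 < ρ
  contDiffAt_z : ∀ p ∈ Metric.ball ((0 : ℝ), xbar) ρ, ContDiffAt ℝ 3 z p
  contDiffAt_V : ∀ p ∈ Metric.ball ((0 : ℝ), xbar) ρ, ContDiffAt ℝ 3 V p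
  relations : ∀ p ∈ Metric.ball ((0 : ℝ), xbar) ρ,
    F (shift i j p.2 p.1 (z p)) - F p.2 = V p • (u (shift i j p.2 p.1 (z p)) - u p.2)
  z_zero : ∀ x ∈ Metric.ball xbar ρ, z (0, x) = 0
  V_zero : ∀ x ∈ Metric.ball xbar ρ, V (0, x) = μ i x
  abs_z_lt : ∀ p ∈ Metric.ball ((0 : ℝ), xbar) ρ, |z p| < ε
  abs_V_lt : ∀ p ∈ Metric.ball ((0 : ℝ), xbar) ρ, |V p - μ i xbar| < ε
  unique : ∀ p ∈ Metric.ball ((0 : ℝ), xbar) ρ, ∀ z' V' : ℝ, |z'| ≤ ε → |V' - μ i xbar| ≤ ε →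
    F (shift i j p.2 p.1 z') - F p.2 = V' • (u (shift i j p.2 p.1 z') - u p.2) →
    z' = z p ∧ (p.1 ≠ 0 → V' = V p)

theorem IsHugoniotBranch.mono {z V : ℝ × State → ℝ} {ρ ρ' ε : ℝ}
    (h : IsHugoniotBranch u F μ xbar i j z V ρ ε) (h0 : 0 < ρ') (hρ : ρ' ≤ ρ) :
    IsHugoniotBranch u F μ xbar i j z V ρ' ε := by
  have hb := Metric.ball_subset_ball (x := ((0 : ℝ), xbar)) hρ
  have hb' := Metric.ball_subset_ball (x := xbar) hρ
  exact ⟨h0, fun p hp => h.contDiffAt_z p (hb hp), fun p hp => h.contDiffAt_V p (hb hp),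
    fun p hp => h.relations p (hb hp), fun x hx => h.z_zero x (hb' hx),
    fun x hx => h.V_zero x (hb' hx), fun p hp => h.abs_z_lt p (hb hp),
    fun p hp => h.abs_V_lt p (hb hp), fun p hp => h.unique p (hb hp)⟩

theorem IsDiagonalSystem.exists_isHugoniotBranch (h : IsDiagonalSystem u F μ xbar R)
    (hij : i ≠ j) {ε₁ : ℝ} (hε₁ : 0 < ε₁) :
    ∃ z V ρ, ∃ ε ≤ ε₁, IsHugoniotBranch u F μ xbar i j z V ρ ε := by
  have hx : xbar ∈ Metric.ball xbar R := Metric.mem_ball_self h.pos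
  have hE := (h.contDiff_rankineHugoniot i j).contDiffAt (x := ((0, xbar), (0, μ i xbar)))
  have hE0 : rankineHugoniot u F i j ((0, xbar), (0, μ i xbar)) = 0 := by
    rw [h.rankineHugoniot_zero i j _ _ hx]; simp
  set ψ := hE.implicitFunction (by simp) (h.isInvertible hij) with hψ
  have hψ0 : ψ (0, xbar) = (0, μ i xbar) :=
    hE.implicitFunction_apply_self (by simp) (h.isInvertible hij)
  have hψc : ContDiffAt ℝ 3 ψ (0, xbar) :=
    (hE.contDiffAt_implicitFunction (by simp) (h.isInvertible hij)).of_le (by norm_cast)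
  have hψe : ∀ᶠ p in 𝓝 ((0 : ℝ), xbar), rankineHugoniot u F i j (p, ψ p) = 0 := by
    have := hE.eventually_apply_implicitFunction (by simp) (h.isInvertible hij)
    rwa [hE0] at this
  obtain ⟨η, hη, hu⟩ := Metric.eventually_nhds_iff_ball.1
    (hE.eventually_apply_eq_iff_implicitFunction (by simp) (h.isInvertible hij))
  rw [hE0] at hu
  obtain ⟨ε₀, hε₀, hcone⟩ := h.exists_cone hij (θ := η / 2) (by positivity)
  set ε := min (min ε₀ (η / 2)) ε₁ with hε
  have hεpos : 0 < ε := by positivity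
  have c1 : ContinuousAt (fun p : ℝ × State => p.1 * (ψ p).1) (0, xbar) :=
    continuousAt_fst.mul hψc.continuousAt.fst
  have c2 : ContinuousAt (fun p : ℝ × State => (ψ p).2) (0, xbar) := hψc.continuousAt.snd
  have ev : ∀ᶠ p in 𝓝 ((0 : ℝ), xbar), ContDiffAt ℝ 3 ψ p ∧
      rankineHugoniot u F i j (p, ψ p) = 0 ∧ |p.1 * (ψ p).1| < ε ∧ |(ψ p).2 - μ i xbar| < ε ∧
      p ∈ Metric.ball ((0 : ℝ), xbar) (min R (min ε η)) := by
    refine (hψc.eventually (by simp)).and (hψe.and (Eventually.and ?_ (Eventually.and ?_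
      (Metric.ball_mem_nhds _ (lt_min h.pos (lt_min hεpos hη))))))
    · exact c1.abs.eventually_lt continuousAt_const (by simp [hεpos])
    · exact (c2.sub continuousAt_const).abs.eventually_lt continuousAt_const (by simp [hψ0, hεpos])
  obtain ⟨ρ, hρ, hb⟩ := Metric.eventually_nhds_iff_ball.1 ev
  have hz0 : ∀ x ∈ Metric.ball xbar ρ, ((0 : ℝ), x) ∈ Metric.ball ((0 : ℝ), xbar) ρ := by
    intro x hx
    rw [← ball_prod_same]
    exact ⟨Metric.mem_ball_self hρ, hx⟩
  have hsplit : ∀ p ∈ Metric.ball ((0 : ℝ), xbar) ρ, |p.1| < min R (min ε η) ∧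
      dist p.2 xbar < min R (min ε η) := by
    intro p hp
    have := (hb p hp).2.2.2.2
    rwa [Metric.mem_ball, Prod.dist_eq, max_lt_iff, Real.dist_0_eq_abs] at this
  refine ⟨fun p => p.1 * (ψ p).1, fun p => (ψ p).2, ρ, ε, min_le_right _ _, hρ, ?_, ?_, ?_, ?_, ?_, ?_, ?_, ?_⟩
  · exact fun p hp => contDiffAt_fst.mul (hb p hp).1.fst
  · exact fun p hp => (hb p hp).1.snd
  · intro p hp
    have := h.smul_rankineHugoniot i j p.1 (ψ p).1 (ψ p).2 p.2
    rw [(hb p hp).2.1, smul_zero] at this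
    exact sub_eq_zero.1 this.symm
  · intro x _; simp
  · intro x hx
    have hxR : x ∈ Metric.ball xbar R := (hsplit _ (hz0 x hx)).2.trans_le (min_le_left _ _)
    have h1 := (hb _ (hz0 x hx)).2.1
    have h2 := h.rankineHugoniot_zero i j (ψ (0, x)).1 (ψ (0, x)).2 hxR
    have h3 := h.eq_zero_of_smul_add_smul hij hxR (h2.symm.trans h1)
    linarith [h3.1]
  · exact fun p hp => (hb p hp).2.2.1
  · exact fun p hp => (hb p hp).2.2.2.1
  · rintro ⟨s, x⟩ hp z' V' hz' hV' hRH
    obtain ⟨hs, hxx⟩ := hsplit _ hp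
    simp only [lt_min_iff] at hs hxx
    dsimp only at hRH ⊢
    have hε₀' : ε ≤ ε₀ := (min_le_left _ _).trans (min_le_left _ _)
    have hεη : ε ≤ η / 2 := (min_le_left _ _).trans (min_le_right _ _)
    have hc := hcone s z' V' x (by linarith) (by linarith) (by linarith) (by linarith) hRH
    rcases eq_or_ne s 0 with rfl | hs0
    · simpa using hc
    · have hζ : s * (z' / s) = z' := by field_simp
      have hsp : 0 < |s| := abs_pos.2 hs0
      have hζ' : |z' / s| ≤ η / 2 := by
        rw [abs_div, div_le_iff₀ hsp]; exact hc
      have h0 : rankineHugoniot u F i j ((s, x), (z' / s, V')) = 0 := by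
        have := h.smul_rankineHugoniot i j s (z' / s) V' x
        rw [hζ, sub_eq_zero.2 hRH] at this
        exact (smul_eq_zero.1 this).resolve_left hs0
      have := (hu ((s, x), (z' / s, V')) (by
        simp only [Metric.mem_ball, Prod.dist_eq, max_lt_iff, Real.dist_eq, sub_zero]
        refine ⟨⟨?_, ?_⟩, ?_, ?_⟩ <;> linarith)).1 h0
      rw [← hψ] at this
      simp only [this, hζ, true_and]
      exact fun _ => trivial

end

/-! ### Second-order contact of Hugoniot and rarefaction curves -/

section

variable {u F : State → State} {μ : Fin 2 → State → ℝ} {xbar : State} {R : ℝ} {i j : Fin 2}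

theorem hasDerivAt_prodMk_fst {h : ℝ × State → ℝ} {s : ℝ} {x : State}
    (hd : DifferentiableAt ℝ h (s, x)) :
    HasDerivAt (fun t => h (t, x)) (fderiv ℝ h (s, x) (1, 0)) s :=
  hd.hasFDerivAt.comp_hasDerivAt s ((hasDerivAt_id s).prodMk (hasDerivAt_const s x))

theorem ContDiffAt.fderiv_apply_const {h : ℝ × State → ℝ} {p v : ℝ × State} {m n : ℕ}
    (hd : ContDiffAt ℝ n h p) (hmn : m + 1 ≤ n) :
    ContDiffAt ℝ m (fun q => fderiv ℝ h q v) p :=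
  (hd.fderiv_right (m := m) (by exact_mod_cast hmn)).clm_apply contDiffAt_const

theorem hasDerivAt_wedge {a b : ℝ → State} {a' b' : State} {t : ℝ} (ha : HasDerivAt a a' t)
    (hb : HasDerivAt b b' t) :
    HasDerivAt (fun r => wedge (a r) (b r)) (wedge a' (b t) + wedge (a t) b') t := by
  have ha' := hasDerivAt_pi.1 ha
  have hb' := hasDerivAt_pi.1 hb
  refine (((ha' 0).mul (hb' 1)).sub ((ha' 1).mul (hb' 0))).congr_deriv ?_
  simp only [wedge]; ring

/-- The curves of the `i`-th Hugoniot branch and of the `i`-th rarefaction have a contact of second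
order at their starting point. Differentiating the Rankine-Hugoniot relations along the branch and
taking the determinant with the `i`-th eigenvector `rᵢ` gives
`det (rᵢ, (μⱼ - V) rⱼ) z' = V' det (rᵢ, u - u₀)`, and the right-hand side is `o(s)`. -/
theorem IsHugoniotBranch.deriv_eq_zero {z V : ℝ × State → ℝ} {ρ ε : ℝ}
    (hb : IsHugoniotBranch u F μ xbar i j z V ρ ε) (h : IsDiagonalSystem u F μ xbar R)
    (hij : i ≠ j) (hρR : ρ ≤ R) {x : State} (hx : x ∈ Metric.ball xbar ρ) :
    fderiv ℝ z (0, x) (1, 0) = 0 ∧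
      fderiv ℝ (fun p => fderiv ℝ z p (1, 0)) (0, x) (1, 0) = 0 := by
  have hxR : x ∈ Metric.ball xbar R := Metric.ball_subset_ball hρR hx
  have hx0 : ((0 : ℝ), x) ∈ Metric.ball ((0 : ℝ), xbar) ρ := by
    rw [← ball_prod_same]
    exact ⟨Metric.mem_ball_self hb.pos, hx⟩
  set z' : ℝ → ℝ := fun s => fderiv ℝ z (s, x) (1, 0) with hz'
  set V' : ℝ → ℝ := fun s => fderiv ℝ V (s, x) (1, 0) with hV'
  set y : ℝ → State := fun s => shift i j x s (z (s, x)) with hy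
  set A : ℝ → ℝ := fun s => wedge (fderiv ℝ u (y s) (Pi.single i 1))
    (fderiv ℝ F (y s) (Pi.single j 1) - V (s, x) • fderiv ℝ u (y s) (Pi.single j 1)) with hA
  have hball : ∀ᶠ s in 𝓝 (0 : ℝ), (s, x) ∈ Metric.ball ((0 : ℝ), xbar) ρ :=
    (Continuous.prodMk_left x).continuousAt.eventually_mem (Metric.isOpen_ball.mem_nhds hx0)
  have dz : ∀ s, (s, x) ∈ Metric.ball ((0 : ℝ), xbar) ρ →
      HasDerivAt (fun t => z (t, x)) (z' s) s := fun s hs =>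
    hasDerivAt_prodMk_fst ((hb.contDiffAt_z _ hs).differentiableAt (by simp))
  have dV : ∀ s, (s, x) ∈ Metric.ball ((0 : ℝ), xbar) ρ →
      HasDerivAt (fun t => V (t, x)) (V' s) s := fun s hs =>
    hasDerivAt_prodMk_fst ((hb.contDiffAt_V _ hs).differentiableAt (by simp))
  have dy : ∀ s, (s, x) ∈ Metric.ball ((0 : ℝ), xbar) ρ →
      HasDerivAt y (Pi.single i 1 + z' s • Pi.single j 1) s := by
    intro s hs
    refine HasDerivAt.const_add x (HasDerivAt.add ?_ ((dz s hs).smul_const _))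
    simpa using (hasDerivAt_id s).smul_const (Pi.single i 1 : State)
  have du := fun p => (h.smooth_u.differentiable (by simp) p).hasFDerivAt
  have dF := fun p => (h.smooth_F.differentiable (by simp) p).hasFDerivAt
  have y0 : y 0 = x := by simp [hy, shift, hb.z_zero x hx]
  have hyR : ∀ᶠ s in 𝓝 (0 : ℝ), y s ∈ Metric.ball xbar R :=
    (dy 0 hx0).continuousAt.eventually_mem (by rw [y0]; exact Metric.isOpen_ball.mem_nhds hxR)
  have key : ∀ᶠ s in 𝓝 (0 : ℝ),
      A s * z' s = V' s * wedge (fderiv ℝ u (y s) (Pi.single i 1)) (u (y s) - u x) := by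
    filter_upwards [hball, hyR, hball.eventually_nhds] with s hs hsR hev
    have d1 := ((dF (y s)).comp_hasDerivAt s (dy s hs)).sub_const (F x)
    have d2 := (dV s hs).smul (((du (y s)).comp_hasDerivAt s (dy s hs)).sub_const (u x))
    have e := d1.unique (d2.congr_of_eventuallyEq (hev.mono fun t ht => hb.relations _ ht))
    have e' := congrArg (wedge (fderiv ℝ u (y s) (Pi.single i 1))) e
    simp only [map_add, map_smul, wedge_add_right, wedge_sub_right, wedge_smul_right,
      h.partial_F i _ hsR, wedge_self, Function.comp_apply] at e'
    simp only [hA, wedge_sub_right, wedge_smul_right]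
    linarith
  have hA0 : A 0 ≠ 0 := by
    simp only [hA, y0, hb.V_zero x hx, h.partial_F j _ hxR, ← sub_smul, wedge_smul_right]
    exact mul_ne_zero (h.speed_ne hij hxR) (h.wedge_ne hij hxR)
  have hz0 : z' 0 = 0 := by
    have := key.self_of_nhds
    rw [y0, sub_self, wedge_zero_right, mul_zero] at this
    exact (mul_eq_zero.1 this).resolve_left hA0
  refine ⟨hz0, ?_⟩
  have dz' := hasDerivAt_prodMk_fst (((hb.contDiffAt_z _ hx0).fderiv_apply_const (m := 2) (n := 3)
    (v := (1, 0)) (by norm_num)).differentiableAt (by simp))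
  have dV' := hasDerivAt_prodMk_fst (((hb.contDiffAt_V _ hx0).fderiv_apply_const (m := 2) (n := 3)
    (v := (1, 0)) (by norm_num)).differentiableAt (by simp))
  have dfd : ∀ {g : State → State}, ContDiff ℝ ∞ g → ∀ k : Fin 2,
      DifferentiableAt ℝ (fun s => fderiv ℝ g (y s) (Pi.single k 1)) 0 := by
    intro g hg k
    have := ((hg.fderiv_right (m := ∞) (by simp)).differentiable (by simp) (y 0)).comp
      (0 : ℝ) (dy 0 hx0).differentiableAt
    exact this.clm_apply (differentiableAt_const _)
  have dA : DifferentiableAt ℝ A 0 :=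
    (hasDerivAt_wedge (dfd h.smooth_u i).hasDerivAt
      ((dfd h.smooth_F j).sub ((dV 0 hx0).differentiableAt.smul
        (dfd h.smooth_u j))).hasDerivAt).differentiableAt
  have dl := dA.hasDerivAt.mul dz'
  have dr := dV'.mul (hasDerivAt_wedge (dfd h.smooth_u i).hasDerivAt
    (((du (y 0)).comp_hasDerivAt 0 (dy 0 hx0)).sub_const (u x)))
  have e := dl.unique (dr.congr_of_eventuallyEq key)
  simp only [Function.comp_apply, y0, sub_self, wedge_zero_right, hz0, zero_smul, add_zero, wedge_self,
    mul_zero] at e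
  have hz00 : fderiv ℝ z (0, x) (1, 0) = 0 := hz0
  rw [hz00, mul_zero, zero_add] at e
  exact (mul_eq_zero.1 e).resolve_left hA0

theorem IsHugoniotBranch.exists_isCubic {z V : ℝ × State → ℝ} {ρ ε : ℝ}
    (hb : IsHugoniotBranch u F μ xbar i j z V ρ ε) (h : IsDiagonalSystem u F μ xbar R)
    (hij : i ≠ j) : ∃ ρ' K, IsCubic (fun s x => z (s, x)) xbar ρ' K := by
  set z' : ℝ × State → ℝ := fun p => fderiv ℝ z p (1, 0) with hz'
  set z'' : ℝ × State → ℝ := fun p => fderiv ℝ z' p (1, 0) with hz''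
  have c1 : ∀ p ∈ Metric.ball ((0 : ℝ), xbar) ρ, ContDiffAt ℝ 2 z' p := fun p hp =>
    (hb.contDiffAt_z _ hp).fderiv_apply_const (m := 2) (n := 3) (by norm_num)
  have c2 : ∀ p ∈ Metric.ball ((0 : ℝ), xbar) ρ, ContDiffAt ℝ 1 z'' p := fun p hp => by
    exact_mod_cast (c1 _ hp).fderiv_apply_const (m := 1) (n := 2) (by norm_num)
  -- the second derivative in `s` is `C¹`, hence Lipschitz near `(0, xbar)`
  obtain ⟨K, t, ht, hK⟩ := (c2 _ (Metric.mem_ball_self hb.pos)).exists_lipschitzOnWith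
  obtain ⟨η, hη, hηt⟩ := Metric.mem_nhds_iff.1 ht
  set r := min η (min ρ R)
  have hr : 0 < r := lt_min hη (lt_min hb.pos h.pos)
  have hb' : IsHugoniotBranch u F μ xbar i j z V r ε :=
    hb.mono hr ((min_le_right _ _).trans (min_le_left _ _))
  have hmem : ∀ s, |s| < r → ∀ x ∈ Metric.ball xbar r, (s, x) ∈ Metric.ball ((0 : ℝ), xbar) r := by
    intro s hs x hx
    rw [← ball_prod_same]
    exact ⟨by simpa using hs, hx⟩
  have hρ := Metric.ball_subset_ball (x := ((0 : ℝ), xbar))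
    ((min_le_right _ _).trans (min_le_left _ _) : r ≤ ρ)
  have hlip : ∀ p ∈ Metric.ball ((0 : ℝ), xbar) r, ∀ q ∈ Metric.ball ((0 : ℝ), xbar) r,
      |z'' p - z'' q| ≤ K * dist p q := by
    intro p hp q hq
    have hs := Metric.ball_subset_ball (x := ((0 : ℝ), xbar)) (min_le_left _ _ : r ≤ η)
    exact hK.dist_le_mul p (hηt (hs hp)) q (hηt (hs hq))
  have h0 : |(0 : ℝ)| < r := by simpa using hr
  have hd := fun x (hx : x ∈ Metric.ball xbar r) =>
    hb'.deriv_eq_zero h hij ((min_le_right _ _).trans (min_le_right _ _)) hx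
  refine ⟨r, K, isCubic_of_hasDerivAt (z' := fun s x => z' (s, x)) (z'' := fun s x => z'' (s, x))
    hr K.2 ?_ ?_ hb'.z_zero (fun x hx => (hd x hx).1) ?_ ?_⟩
  · exact fun s hs x hx => hasDerivAt_prodMk_fst
      ((hb'.contDiffAt_z _ (hmem s hs x hx)).differentiableAt (by simp))
  · exact fun s hs x hx => hasDerivAt_prodMk_fst
      ((c1 _ (hρ (hmem s hs x hx))).differentiableAt (by simp))
  · intro s hs x hx
    have := hlip _ (hmem s hs x hx) _ (hmem 0 h0 x hx)
    rw [show z'' (0, x) = 0 from (hd x hx).2, sub_zero] at this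
    simpa [Prod.dist_eq] using this
  · intro s hs x hx y hy
    have := hlip _ (hmem s hs x hx) _ (hmem s hs y hy)
    simpa [Prod.dist_eq] using this

end

/-! ### Wave curves in Riemann coordinates -/

section

theorem shift_apply_left {i j : Fin 2} (hij : i ≠ j) (x : State) (s z : ℝ) :
    shift i j x s z i = x i + s := by
  simp [shift, Pi.single_eq_of_ne hij]

theorem shift_apply_right {i j : Fin 2} (hij : i ≠ j) (x : State) (s z : ℝ) :
    shift i j x s z j = x j + z := by
  simp [shift, Pi.single_eq_of_ne hij.symm]

theorem eq_shift_iff {i j : Fin 2} (hij : i ≠ j) {x y : State} {s z : ℝ} :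
    y = shift i j x s z ↔ y i = x i + s ∧ y j = x j + z := by
  constructor
  · rintro rfl
    exact ⟨shift_apply_left hij _ _ _, shift_apply_right hij _ _ _⟩
  · rintro ⟨h1, h2⟩
    ext k
    have : k = i ∨ k = j := by omega
    rcases this with rfl | rfl
    · rw [h1, shift_apply_left hij]
    · rw [h2, shift_apply_right hij]

theorem dist_shift_le (i j : Fin 2) (x : State) (s z : ℝ) :
    dist (shift i j x s z) x ≤ |s| + |z| := by
  rw [dist_eq_norm, shift, add_sub_cancel_left]
  exact (norm_add_le _ _).trans (by simp [norm_smul, Pi.norm_single])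

/-- Localization: a map that is smooth near `x` agrees near `x` with a globally smooth map. -/
theorem exists_contDiff_eq_on_ball {g : State → State} {T : Set State} (hT : IsOpen T)
    (hg : ContDiffOn ℝ ∞ g T) {x : State} (hx : x ∈ T) :
    ∃ g' : State → State, ContDiff ℝ ∞ g' ∧ ∃ R > 0, ∀ y ∈ Metric.ball x R, g' y = g y := by
  obtain ⟨η, hη, hb⟩ := Metric.isOpen_iff.1 hT x hx
  let χ : ContDiffBump x := ⟨η / 4, η / 2, by positivity, by linarith⟩
  refine ⟨fun y => χ y • g y, contDiff_iff_contDiffAt.2 fun y => ?_, η / 4, by positivity, ?_⟩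
  · by_cases hy : y ∈ T
    · exact χ.contDiffAt.smul (hg.contDiffAt (hT.mem_nhds hy))
    · have hy' : y ∉ tsupport χ := fun h => hy (hb (by
        rw [χ.tsupport_eq] at h
        exact Metric.closedBall_subset_ball (by change η / 2 < η; linarith) h))
      refine contDiffAt_const (c := (0 : State)) |>.congr_of_eventuallyEq ?_
      filter_upwards [notMem_tsupport_iff_eventuallyEq.1 hy'] with z hz
      simp [hz]
  · intro y hy
    have : χ y = 1 := χ.one_of_mem_closedBall (Metric.ball_subset_closedBall hy)
    simp [this]

theorem wedge_ne_zero_of_eigenvectors {A : State →L[ℝ] State} {a b : State} {α β : ℝ}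
    (ha : a ≠ 0) (hb : b ≠ 0) (hαβ : α < β) (hAa : A a = α • a) (hAb : A b = β • b) :
    wedge a b ≠ 0 := by
  intro h
  obtain ⟨t, rfl⟩ : ∃ t : ℝ, b = t • a := by
    simp only [wedge] at h
    by_cases h0 : a 0 = 0
    · have h1 : a 1 ≠ 0 := fun h1 => ha (by ext k; fin_cases k <;> simpa)
      refine ⟨b 1 / a 1, ?_⟩
      ext k; fin_cases k
      · simp only [h0, zero_mul, zero_sub, neg_eq_zero, mul_eq_zero, h1, false_or] at h
        simp [h, h0]
      · simp [h1]
    · refine ⟨b 0 / a 0, ?_⟩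
      ext k; fin_cases k
      · simp [h0]
      · simp only [Fin.mk_one, Pi.smul_apply, smul_eq_mul]
        field_simp
        linarith
  rw [map_smul, hAa, smul_comm, ← sub_eq_zero, ← sub_smul] at hAb
  exact (smul_ne_zero (sub_ne_zero.2 hαβ.ne) hb) hAb

variable {Ω : Set State} {f : State → State} {lam : Fin 2 → State → ℝ} {r : Fin 2 → State → State}
  {ubar : State} {w : OpenPartialHomeomorph State State}

theorem IsRiemannCoordinates.exists_isDiagonalSystem (hw : IsRiemannCoordinates Ω r ubar w)
    (hsys : IsMonotoneHyperbolic Ω f lam r) :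
    ∃ u F R, IsDiagonalSystem u F (fun k x => lam k (w.symm x)) (w ubar) R ∧
      ∀ x ∈ Metric.ball (w ubar) R, x ∈ w.target ∧ u x = w.symm x ∧ F x = f (w.symm x) := by
  have hx : w ubar ∈ w.target := w.map_source hw.mem_source
  have hmap : ∀ x ∈ w.target, w.symm x ∈ Ω := fun x hx => hw.source_subset (w.map_target hx)
  obtain ⟨u, hu, R₁, hR₁, hu'⟩ := exists_contDiff_eq_on_ball w.open_target hw.smooth_symm hx
  obtain ⟨F, hF, R₂, hR₂, hF'⟩ := exists_contDiff_eq_on_ball w.open_target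
    (hsys.smooth_flux.comp hw.smooth_symm hmap) hx
  obtain ⟨R₃, hR₃, hb⟩ := Metric.isOpen_iff.1 w.open_target _ hx
  set R := min R₁ (min R₂ R₃)
  have hR : 0 < R := lt_min hR₁ (lt_min hR₂ hR₃)
  have h1 := Metric.ball_subset_ball (x := w ubar) (min_le_left _ _ : R ≤ R₁)
  have h2 := Metric.ball_subset_ball (x := w ubar)
    ((min_le_right _ _).trans (min_le_left _ _) : R ≤ R₂)
  have h3 := Metric.ball_subset_ball (x := w ubar)
    ((min_le_right _ _).trans (min_le_right _ _) : R ≤ R₃)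
  have du : ∀ k, ∀ x ∈ Metric.ball (w ubar) R,
      fderiv ℝ u x (Pi.single k 1) = r k (w.symm x) := by
    intro k x hx
    have : u =ᶠ[𝓝 x] w.symm := by
      filter_upwards [Metric.isOpen_ball.mem_nhds hx] with y hy using hu' y (h1 hy)
    rw [this.fderiv_eq, hw.partial_eq k x (hb (h3 hx))]
  have heig := fun k x hx => hsys.eigenvector k (w.symm x) (hmap x (hb (h3 hx)))
  refine ⟨u, F, R, ⟨hR, hu, hF, ?_, ?_, ?_⟩,
    fun x hx => ⟨hb (h3 hx), hu' x (h1 hx), hF' x (h2 hx)⟩⟩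
  · intro k x hx
    have e : F =ᶠ[𝓝 x] f ∘ w.symm := by
      filter_upwards [Metric.isOpen_ball.mem_nhds hx] with y hy using hF' y (h2 hy)
    have hT := hb (h3 hx)
    have df : DifferentiableAt ℝ f (w.symm x) :=
      (hsys.smooth_flux.contDiffAt (hsys.isOpen.mem_nhds (hmap x hT))).differentiableAt (by simp)
    have dw : DifferentiableAt ℝ w.symm x :=
      (hw.smooth_symm.contDiffAt (w.open_target.mem_nhds hT)).differentiableAt (by simp)
    rw [e.fderiv_eq, fderiv_comp x df dw, ContinuousLinearMap.comp_apply,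
      hw.partial_eq k x hT, du k x hx]
    exact heig k x hx
  · intro x hx
    rw [du 0 x hx, du 1 x hx]
    have hΩ := hmap x (hb (h3 hx))
    exact wedge_ne_zero_of_eigenvectors (hsys.eigenvector_ne_zero 0 _ hΩ)
      (hsys.eigenvector_ne_zero 1 _ hΩ) (hsys.strict _ hΩ) (heig 0 x hx) (heig 1 x hx)
  · exact fun x hx => hsys.strict _ (hmap x (hb (h3 hx)))

/-- In the ball of radius `ρ` around `xbar` in Riemann coordinates, the wave curve `T` of family `i`
adds the strength `s` to the `i`-th coordinate and `G s x` to the `j`-th one. -/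
def IsGraphOf (w : OpenPartialHomeomorph State State) (T : ℝ → State → State → Prop) (i j : Fin 2)
    (G : ℝ → State → ℝ) (xbar : State) (ρ : ℝ) : Prop :=
  ∀ s : ℝ, |s| < ρ → ∀ ul ∈ w.source, w ul ∈ Metric.ball xbar ρ → ∀ v,
    T s ul v ↔ v ∈ w.source ∧ w v = shift i j (w ul) s (G s (w ul))

theorem IsGraphOf.mono {T : ℝ → State → State → Prop} {i j : Fin 2} {G : ℝ → State → ℝ}
    {xbar : State} {ρ ρ' : ℝ} (h : IsGraphOf w T i j G xbar ρ) (hρ : ρ' ≤ ρ) :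
    IsGraphOf w T i j G xbar ρ' := fun s hs ul hul hb =>
  h s (hs.trans_le hρ) ul hul (Metric.ball_subset_ball hρ hb)

theorem IsRiemannCoordinates.exists_hugoniot (hw : IsRiemannCoordinates Ω r ubar w)
    (hsys : IsMonotoneHyperbolic Ω f lam r) {i j : Fin 2} (hij : i ≠ j) :
    ∃ G ρ K, IsCubic G (w ubar) ρ K ∧ IsGraphOf w (Hugoniot f lam w i) i j G (w ubar) ρ := by
  obtain ⟨u, F, R, h, hrep⟩ := hw.exists_isDiagonalSystem hsys
  obtain ⟨z, V, ρ₀, ε, hε, hb₀⟩ :=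
    h.exists_isHugoniotBranch hij (ε₁ := R / 3) (by linarith [h.pos])
  obtain ⟨ρ₁, K, hc₁⟩ := hb₀.exists_isCubic h hij
  set ρ := min (min ρ₀ ρ₁) (R / 3)
  have hρ : 0 < ρ := lt_min (lt_min hb₀.pos hc₁.pos) (by linarith [h.pos])
  have hc := hc₁.mono hρ ((min_le_left _ _).trans (min_le_right _ _)) le_rfl
  have hb := hb₀.mono hρ ((min_le_left _ _).trans (min_le_left _ _))
  have hρR : ρ ≤ R / 3 := min_le_right _ _
  have hR := h.pos
  refine ⟨_, ρ, K, hc, fun s hs ul hul hx v => ?_⟩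
  have hmem : ∀ t ∈ uIcc 0 s, (t, w ul) ∈ Metric.ball ((0 : ℝ), w ubar) ρ := by
    intro t ht
    rw [← ball_prod_same]
    exact ⟨by simpa using (abs_le_of_mem_uIcc_zero ht).trans_lt hs, hx⟩
  have hballR : ∀ t ∈ uIcc 0 s, ∀ z', |z'| ≤ ε →
      shift i j (w ul) t z' ∈ Metric.ball (w ubar) R := by
    intro t ht z' hz'
    have h1 := dist_shift_le i j (w ul) t z'
    have h2 := abs_le_of_mem_uIcc_zero ht
    have h3 := dist_triangle (shift i j (w ul) t z') (w ul) (w ubar)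
    have h4 := Metric.mem_ball.1 hx
    rw [Metric.mem_ball]
    linarith
  have hulR := hrep (w ul) (Metric.ball_subset_ball (by linarith) hx)
  rw [w.left_inv hul] at hulR
  constructor
  · rintro ⟨γ, W, hγ, hW, rfl, rfl, hW0, hRH⟩
    refine ⟨(hRH s right_mem_uIcc).1, ?_⟩
    set x := w (γ 0)
    set Z : ℝ → ℝ := fun t => w (γ t) j - x j with hZ
    have hy : ∀ t ∈ uIcc 0 s, w (γ t) = shift i j x t (Z t) := fun t ht =>
      (eq_shift_iff hij).2 ⟨(hRH t ht).2.1, by simp [hZ]⟩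
    have hZc : ContinuousOn Z (uIcc 0 s) := by
      have : ContinuousOn (fun t => w (γ t)) (uIcc 0 s) :=
        w.continuousOn.comp hγ fun t ht => (hRH t ht).1
      exact (continuousOn_pi.1 this j).sub continuousOn_const
    -- the curve stays on the smooth branch as long as `φ ≤ ε`, where in fact `φ < ε`
    set φ : ℝ → ℝ := fun t => max |Z t| |W t - lam i (w.symm (w ubar))| with hφ
    have hφc : ContinuousOn φ (uIcc 0 s) :=
      hZc.abs.sup (hW.sub continuousOn_const).abs
    have huniq : ∀ t ∈ uIcc 0 s, φ t ≤ ε → Z t = z (t, x) ∧ (t ≠ 0 → W t = V (t, x)) := by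
      intro t ht hφt
      have hZt := (le_max_left _ _).trans hφt
      have hWt := (le_max_right _ _).trans hφt
      refine hb.unique _ (hmem t ht) _ _ hZt hWt ?_
      have hyt := hrep _ (hballR t ht _ hZt)
      rw [hyt.2.2, hyt.2.1, hulR.2.1, hulR.2.2, ← hy t ht, w.left_inv (hRH t ht).1]
      exact (hRH t ht).2.2
    have hφ0 : φ 0 < ε := by
      have h0 := hb.abs_V_lt _ (hmem 0 left_mem_uIcc)
      rw [hb.V_zero x hx, w.left_inv hul] at h0
      simp only [hφ, hZ, x, sub_self, abs_zero, hW0]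
      exact max_lt ((abs_nonneg _).trans_lt h0) h0
    have hφlt : ∀ t ∈ uIcc 0 s, φ t ≤ ε → φ t < ε := by
      intro t ht hφt
      rcases eq_or_ne t 0 with rfl | ht0
      · exact hφ0
      · obtain ⟨e1, e2⟩ := huniq t ht hφt
        simp only [hφ, e1, e2 ht0]
        exact max_lt (hb.abs_z_lt _ (hmem t ht)) (hb.abs_V_lt _ (hmem t ht))
    have hfin : φ s ≤ ε := by
      by_contra! hlt
      obtain ⟨t, ht, hte⟩ := intermediate_value_uIcc hφc (mem_uIcc_of_le hφ0.le hlt.le)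
      exact (hφlt t ht hte.le).ne hte
    rw [hy s right_mem_uIcc, (huniq s right_mem_uIcc hfin).1]
  · rintro ⟨hv, hwv⟩
    have hm : ∀ t ∈ uIcc 0 s, shift i j (w ul) t (z (t, w ul)) ∈ Metric.ball (w ubar) R :=
      fun t ht => hballR t ht _ (hb.abs_z_lt _ (hmem t ht)).le
    have hpair : ContinuousOn (fun t : ℝ => (t, w ul)) (uIcc 0 s) := by fun_prop
    have hzc : ContinuousOn (fun t => z (t, w ul)) (uIcc 0 s) := fun t ht =>
      ContinuousAt.comp_continuousWithinAt (f := fun t : ℝ => (t, w ul)) (x := t)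
      (hb.contDiffAt_z _ (hmem t ht)).continuousAt (hpair t ht)
    have hVc : ContinuousOn (fun t => V (t, w ul)) (uIcc 0 s) := fun t ht =>
      ContinuousAt.comp_continuousWithinAt (f := fun t : ℝ => (t, w ul)) (x := t)
      (hb.contDiffAt_V _ (hmem t ht)).continuousAt (hpair t ht)
    have hyc : ContinuousOn (fun t => shift i j (w ul) t (z (t, w ul))) (uIcc 0 s) :=
      continuousOn_const.add ((continuousOn_id.smul continuousOn_const).add
        (hzc.smul continuousOn_const))
    refine ⟨fun t => w.symm (shift i j (w ul) t (z (t, w ul))), fun t => V (t, w ul),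
      w.continuousOn_symm.comp hyc fun t ht => (hrep _ (hm t ht)).1, hVc, ?_, ?_, ?_, ?_⟩
    · simp [shift, hb.z_zero _ hx, w.left_inv hul]
    · simp only [← hwv, w.left_inv hv]
    · simp [hb.V_zero _ hx, w.left_inv hul]
    · intro t ht
      have hyt := hrep _ (hm t ht)
      refine ⟨w.map_target hyt.1, ?_, ?_⟩
      · rw [w.right_inv hyt.1, shift_apply_left hij]
      · have := hb.relations _ (hmem t ht)
        rwa [hyt.2.2, hyt.2.1, hulR.2.1, hulR.2.2] at this

/-- In Riemann coordinates, the integral curves of `r i` are straight lines in the direction of the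
`i`-th axis. -/
theorem IsRiemannCoordinates.rarefaction_iff (hw : IsRiemannCoordinates Ω r ubar w) (i : Fin 2)
    (s : ℝ) (ul v : State) :
    Rarefaction r w i s ul v ↔ ul ∈ w.source ∧ v ∈ w.source ∧ w v = w ul + s • Pi.single i 1 ∧
      ∀ t ∈ uIcc 0 s, w ul + t • Pi.single i 1 ∈ w.target := by
  constructor
  · rintro ⟨γ, rfl, rfl, hγ⟩
    have hline : ∀ t ∈ uIcc 0 s, w (γ t) = w (γ 0) + t • Pi.single i 1 := by
      have hd : ∀ t ∈ uIcc 0 s, HasDerivWithinAt (fun t => w (γ t) - t • (Pi.single i 1 : State))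
          0 (uIcc 0 s) t := by
        intro t ht
        obtain ⟨hs, hdγ⟩ := hγ t ht
        have hT : w (γ t) ∈ w.target := w.map_source hs
        have dw : HasFDerivAt w (fderiv ℝ w (γ t)) (γ t) :=
          ((hw.smooth.contDiffAt (w.open_source.mem_nhds hs)).differentiableAt
            (by simp)).hasFDerivAt
        have dsymm : HasFDerivAt w.symm (fderiv ℝ w.symm (w (γ t))) (w (γ t)) :=
          ((hw.smooth_symm.contDiffAt (w.open_target.mem_nhds hT)).differentiableAt
            (by simp)).hasFDerivAt
        have e := (HasFDerivAt.comp (w (γ t)) (by rwa [w.left_inv hs]) dsymm).unique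
          ((hasFDerivAt_id (w (γ t))).congr_of_eventuallyEq (by
            filter_upwards [w.open_target.mem_nhds hT] with y hy using w.right_inv hy))
        have e' := congrArg (fun L : State →L[ℝ] State => L (Pi.single i 1)) e
        simp only [ContinuousLinearMap.comp_apply, hw.partial_eq i _ hT, w.left_inv hs,
          ContinuousLinearMap.id_apply] at e'
        have h1 := (dw.comp_hasDerivWithinAt t hdγ).sub
          ((hasDerivWithinAt_id t _).smul_const (Pi.single i 1 : State))
        rwa [e', one_smul, sub_self] at h1
      intro t ht
      have := (convex_uIcc 0 s).norm_image_sub_le_of_norm_hasDerivWithin_le (C := 0) hd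
        (by simp) left_mem_uIcc ht
      rw [zero_mul, norm_le_zero_iff, zero_smul, sub_zero, sub_eq_zero, sub_eq_iff_eq_add] at this
      exact this
    refine ⟨(hγ 0 left_mem_uIcc).1, (hγ s right_mem_uIcc).1, hline s right_mem_uIcc, ?_⟩
    intro t ht
    rw [← hline t ht]
    exact w.map_source (hγ t ht).1
  · rintro ⟨hul, hv, hwv, hT⟩
    refine ⟨fun t => w.symm (w ul + t • Pi.single i 1), by simp [w.left_inv hul],
      by simp only [← hwv, w.left_inv hv], fun t ht => ⟨w.map_target (hT t ht), ?_⟩⟩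
    have dsymm : HasFDerivAt w.symm _ (w ul + t • Pi.single i 1) :=
      ((hw.smooth_symm.contDiffAt (w.open_target.mem_nhds (hT t ht))).differentiableAt
        (by simp)).hasFDerivAt
    have hl : HasDerivAt (fun t : ℝ => w ul + t • (Pi.single i 1 : State)) (Pi.single i 1) t := by
      simpa using ((hasDerivAt_id t).smul_const (Pi.single i 1 : State)).const_add (w ul)
    have := (dsymm.comp_hasDerivAt t hl).hasDerivWithinAt (s := uIcc 0 s)
    rwa [hw.partial_eq i _ (hT t ht)] at this

theorem IsRiemannCoordinates.rarefaction_trans (hw : IsRiemannCoordinates Ω r ubar w) {i : Fin 2}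
    {s s' : ℝ} {ul um ur : State} (h1 : Rarefaction r w i s' ul um)
    (h2 : Rarefaction r w i s um ur) : Rarefaction r w i (s + s') ul ur := by
  rw [hw.rarefaction_iff] at h1 h2 ⊢
  obtain ⟨hul, -, e1, t1⟩ := h1
  obtain ⟨-, hur, e2, t2⟩ := h2
  refine ⟨hul, hur, by rw [e2, e1]; module, fun t ht => ?_⟩
  have : t ∈ uIcc 0 s' ∨ t - s' ∈ uIcc 0 s := by
    simp only [mem_uIcc] at ht ⊢
    by_contra! hcon
    obtain ⟨⟨c1, c2⟩, c3, c4⟩ := hcon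
    rcases ht with ht | ht <;> rcases le_total 0 s' with h | h
    · have := c1 ht.1
      have := c3 (by linarith)
      linarith
    · have := c3 (by linarith)
      linarith
    · have := c4 (by linarith [ht.1])
      linarith
    · by_cases h' : s' ≤ t
      · have := c2 h'
        linarith
      · have := c4 (by linarith)
        linarith
  rcases this with h | h
  · exact t1 t h
  · have := t2 _ h
    rw [e1] at this
    convert this using 1
    module

theorem IsRiemannCoordinates.exists_isGraphOf_rarefaction
    (hw : IsRiemannCoordinates Ω r ubar w) :
    ∃ ρ > 0, ∀ i j, IsGraphOf w (Rarefaction r w i) i j (fun _ _ => 0) (w ubar) ρ := by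
  obtain ⟨R, hR, hb⟩ := Metric.isOpen_iff.1 w.open_target _ (w.map_source hw.mem_source)
  refine ⟨R / 2, by positivity, fun i j s hs ul hul hx v => ?_⟩
  simp only [hw.rarefaction_iff, shift, zero_smul, add_zero, hul, true_and]
  refine ⟨fun h => ⟨h.1, h.2.1⟩, fun h => ⟨h.1, h.2, fun t ht => hb ?_⟩⟩
  have h1 := dist_shift_le i j (w ul) t 0
  have h2 := abs_le_of_mem_uIcc_zero ht
  have h3 := dist_triangle (shift i j (w ul) t 0) (w ul) (w ubar)
  have h4 := Metric.mem_ball.1 hx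
  simp only [shift, zero_smul, add_zero, abs_zero] at h1 h3
  rw [Metric.mem_ball]
  linarith

/-- Near `ubar`, the rarefaction and Lax curves of both families are graphs of cubic functions over
the axes of the Riemann coordinates. -/
theorem IsRiemannCoordinates.exists_waveCurve (hw : IsRiemannCoordinates Ω r ubar w)
    (hsys : IsMonotoneHyperbolic Ω f lam r) {i j : Fin 2} (hij : i ≠ j) :
    ∃ G ρ K, IsCubic G (w ubar) ρ K ∧ IsGraphOf w (Rarefaction r w i) i j (fun _ _ => 0) (w ubar) ρ ∧
      IsGraphOf w (Lax f lam r w i) i j G (w ubar) ρ := by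
  obtain ⟨G, ρ₁, K, hG, hH⟩ := hw.exists_hugoniot hsys hij
  obtain ⟨ρ₂, hρ₂, hR⟩ := hw.exists_isGraphOf_rarefaction
  set ρ := min ρ₁ ρ₂
  have hρ : 0 < ρ := lt_min hG.pos hρ₂
  have hG' := hG.mono hρ (min_le_left _ _) le_rfl
  have hH' := hH.mono (min_le_left _ _ : ρ ≤ ρ₁)
  have hR' := (hR i j).mono (min_le_right _ _ : ρ ≤ ρ₂)
  refine ⟨fun s => G (min s 0), ρ, 4 * K, hG'.min_zero, hR', fun s hs ul hul hx v => ?_⟩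
  rw [Lax, hR' s hs ul hul hx v, hH' s hs ul hul hx v]
  rcases lt_trichotomy s 0 with h | rfl | h
  · simp [h.le, h.not_ge]
  · simp [hG'.apply_zero hx]
  · simp [h.le, h.not_ge, hG'.apply_zero hx]

end

/-! ### The Riemann problem -/

section

/-- The state reached from `x` by a wave of family `1` and strength `a` followed by a wave of family
`2` and strength `b`, in Riemann coordinates. The functions `A` and `B` give the changes of the
second and of the first coordinate along the curves of the two families. -/
def riemannMap (A B : ℝ → State → ℝ) (x : State) (a b : ℝ) : State :=
  shift 1 0 (shift 0 1 x a (A a x)) b (B b (shift 0 1 x a (A a x)))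

theorem riemannMap_apply_zero (A B : ℝ → State → ℝ) (x : State) (a b : ℝ) :
    riemannMap A B x a b 0 = x 0 + a + B b (shift 0 1 x a (A a x)) := by
  rw [riemannMap, shift_apply_right (by decide), shift_apply_left (by decide)]

theorem riemannMap_apply_one (A B : ℝ → State → ℝ) (x : State) (a b : ℝ) :
    riemannMap A B x a b 1 = x 1 + A a x + b := by
  rw [riemannMap, shift_apply_left (by decide), shift_apply_right (by decide)]

theorem dist_shift_shift_le (i j : Fin 2) (x : State) (s z s' z' : ℝ) :
    dist (shift i j x s z) (shift i j x s' z') ≤ |s - s'| + |z - z'| := by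
  have : shift i j x s z = shift i j (shift i j x s' z') (s - s') (z - z') := by
    simp only [shift]; module
  rw [this]
  exact dist_shift_le _ _ _ _ _

/-- The radii used for the Riemann problem: states range over the ball of radius `δ` and wave
strengths over `(-c, c)`, in Riemann coordinates. -/
structure IsSmall (ρ K c δ : ℝ) : Prop where
  c_pos : 0 < c
  c_le : 3 * c ≤ ρ
  lip : 32 * K * c ^ 2 ≤ 1
  δ_pos : 0 < δ
  δ_le : 16 * δ ≤ c

variable {A B : ℝ → State → ℝ} {xbar : State} {ρ K c δ : ℝ}

theorem IsCubic.abs_sub_le (hA : IsCubic A xbar ρ K) (hs : IsSmall ρ K c δ) {s t : ℝ}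
    (h1 : |s| ≤ c) (h2 : |t| ≤ c) {x y : State} (hx : x ∈ Metric.ball xbar ρ)
    (hy : y ∈ Metric.ball xbar ρ) : |A s x - A t y| ≤ 1 / 8 * (|s - t| + dist x y) := by
  have hK := hA.nonneg
  have hcρ : c < ρ := by linarith [hs.c_le, hs.c_pos]
  have e1 := hA.sub_bound s t (h1.trans_lt hcρ) (h2.trans_lt hcρ) x hx
  have e2 := hA.lipschitz t (h2.trans_lt hcρ) x hx y hy
  have hl := hs.lip
  have e3 : K * |s - t| * (|s| + |t|) ^ 2 ≤ 1 / 8 * |s - t| := by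
    calc K * |s - t| * (|s| + |t|) ^ 2 ≤ K * |s - t| * (c + c) ^ 2 := by gcongr
      _ = (32 * K * c ^ 2) * (1 / 8 * |s - t|) := by ring
      _ ≤ 1 * (1 / 8 * |s - t|) := by gcongr
      _ = _ := one_mul _
  have e4 : K * |t| ^ 2 * dist x y ≤ 1 / 8 * dist x y := by
    calc K * |t| ^ 2 * dist x y ≤ K * c ^ 2 * dist x y := by gcongr
      _ = (32 * K * c ^ 2) * (1 / 32 * dist x y) := by ring
      _ ≤ 1 * (1 / 32 * dist x y) := by gcongr
      _ ≤ _ := by linarith [dist_nonneg (x := x) (y := y)]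
  have := _root_.abs_sub_le (A s x) (A t x) (A t y)
  linarith

theorem IsCubic.abs_le (hA : IsCubic A xbar ρ K) (hs : IsSmall ρ K c δ) {s : ℝ}
    (h1 : |s| ≤ c) {x : State} (hx : x ∈ Metric.ball xbar ρ) : |A s x| ≤ 1 / 8 * |s| := by
  simpa [hA.apply_zero hx] using
    hA.abs_sub_le hs h1 (t := 0) (by simpa using hs.c_pos.le) hx hx

theorem IsSmall.mem_ball (hs : IsSmall ρ K c δ) {x : State} (hx : x ∈ Metric.ball xbar δ) :
    x ∈ Metric.ball xbar ρ :=
  Metric.ball_subset_ball (by linarith [hs.δ_le, hs.c_le, hs.δ_pos]) hx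

theorem IsCubic.shift_mem_ball (hA : IsCubic A xbar ρ K) (hs : IsSmall ρ K c δ) {s : ℝ}
    (h1 : |s| ≤ c) {x : State} (hx : x ∈ Metric.ball xbar δ) (i j : Fin 2) :
    shift i j x s (A s x) ∈ Metric.ball xbar ρ := by
  have e1 := hA.abs_le hs h1 (hs.mem_ball hx)
  have e2 := dist_shift_le i j x s (A s x)
  have e3 := dist_triangle (shift i j x s (A s x)) x xbar
  have e4 := Metric.mem_ball.1 hx
  have := hs.c_le
  have := hs.δ_le
  have := hs.c_pos
  rw [Metric.mem_ball]
  linarith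

theorem abs_sub_riemannMap_le (hA : IsCubic A xbar ρ K) (hB : IsCubic B xbar ρ K)
    (hs : IsSmall ρ K c δ) {x : State} (hx : x ∈ Metric.ball xbar δ) {a b a' b' : ℝ}
    (ha : |a| ≤ c) (hb : |b| ≤ c) (ha' : |a'| ≤ c) (hb' : |b'| ≤ c) :
    |B b (shift 0 1 x a (A a x)) - B b' (shift 0 1 x a' (A a' x))| ≤
      1 / 8 * |b - b'| + 9 / 64 * |a - a'| ∧ |A a x - A a' x| ≤ 1 / 8 * |a - a'| := by
  have e1 := hA.abs_sub_le hs ha ha' (hs.mem_ball hx) (hs.mem_ball hx)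
  rw [dist_self, add_zero] at e1
  have e2 := hB.abs_sub_le hs hb hb' (hA.shift_mem_ball hs ha hx 0 1)
    (hA.shift_mem_ball hs ha' hx 0 1)
  have e3 := dist_shift_shift_le 0 1 x a (A a x) a' (A a' x)
  exact ⟨by linarith, e1⟩

/-- The strengths of the outgoing waves depend on the right state in a Lipschitz way. -/
theorem riemannMap_stable (hA : IsCubic A xbar ρ K) (hB : IsCubic B xbar ρ K)
    (hs : IsSmall ρ K c δ) {x : State} (hx : x ∈ Metric.ball xbar δ) {a b a' b' : ℝ}
    (ha : |a| ≤ c) (hb : |b| ≤ c) (ha' : |a'| ≤ c) (hb' : |b'| ≤ c) :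
    |a - a'| + |b - b'| ≤ 2 * (|riemannMap A B x a b 0 - riemannMap A B x a' b' 0| +
      |riemannMap A B x a b 1 - riemannMap A B x a' b' 1|) := by
  obtain ⟨e1, e2⟩ := abs_sub_riemannMap_le hA hB hs hx ha hb ha' hb'
  simp only [riemannMap_apply_zero, riemannMap_apply_one]
  set β := B b (shift 0 1 x a (A a x))
  set β' := B b' (shift 0 1 x a' (A a' x))
  have e3 : |a - a'| ≤ |x 0 + a + β - (x 0 + a' + β')| + |β - β'| := by
    calc |a - a'| = |(x 0 + a + β - (x 0 + a' + β')) - (β - β')| := by congr 1; ring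
      _ ≤ _ := abs_sub _ _
  have e4 : |b - b'| ≤ |x 1 + A a x + b - (x 1 + A a' x + b')| + |A a x - A a' x| := by
    calc |b - b'| = |(x 1 + A a x + b - (x 1 + A a' x + b')) - (A a x - A a' x)| := by
          congr 1; ring
      _ ≤ _ := abs_sub _ _
  linarith [abs_nonneg (a - a'), abs_nonneg (b - b')]

theorem abs_apply_sub_lt {x y : State} (hx : x ∈ Metric.ball xbar δ)
    (hy : y ∈ Metric.ball xbar δ) (k : Fin 2) : |y k - x k| < 2 * δ := by
  have h1 := dist_le_pi_dist y x k
  have h2 := dist_triangle_right y x xbar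
  rw [Metric.mem_ball] at hx hy
  rw [Real.dist_eq] at h1
  linarith

/-- Existence for the Riemann problem: after elimination of the second strength, the intermediate
value theorem applies to a scalar equation for the first one. -/
theorem exists_riemannMap_eq (hA : IsCubic A xbar ρ K) (hB : IsCubic B xbar ρ K)
    (hs : IsSmall ρ K c δ) {x y : State} (hx : x ∈ Metric.ball xbar δ)
    (hy : y ∈ Metric.ball xbar δ) :
    ∃ a b, |a| < c ∧ |b| < c ∧ y = riemannMap A B x a b := by
  have hc := hs.c_pos
  have hδ := hs.δ_le
  have h0 := abs_apply_sub_lt hx hy 0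
  have h1 := abs_apply_sub_lt hx hy 1
  have hab : ∀ a ∈ Icc (-(c / 2)) (c / 2), |a| ≤ c / 2 := fun a ha => _root_.abs_le.2 ha
  -- the second equation of the system determines `b` in terms of `a`
  set b : ℝ → ℝ := fun a => y 1 - x 1 - A a x with hb
  have hbc : ∀ a ∈ Icc (-(c / 2)) (c / 2), |b a| ≤ c / 4 := by
    intro a ha
    have e := hA.abs_le hs ((hab a ha).trans (by linarith)) (hs.mem_ball hx)
    have := abs_sub (y 1 - x 1) (A a x)
    have := hab a ha
    simp only [hb]
    linarith
  set k : ℝ → ℝ := fun a => a + B (b a) (shift 0 1 x a (A a x)) with hk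
  have hkB : ∀ a ∈ Icc (-(c / 2)) (c / 2), |B (b a) (shift 0 1 x a (A a x))| ≤ c / 32 := by
    intro a ha
    have e := hB.abs_le hs ((hbc a ha).trans (by linarith))
      (hA.shift_mem_ball hs ((hab a ha).trans (by linarith)) hx 0 1)
    have := hbc a ha
    linarith
  have hcont : ContinuousOn k (Icc (-(c / 2)) (c / 2)) := by
    refine (LipschitzOnWith.of_dist_le_mul (K := 2) fun a ha a' ha' => ?_).continuousOn
    have h3 := hab a ha
    have h4 := hab a' ha'
    have h5 := hbc a ha
    have h6 := hbc a' ha'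
    obtain ⟨e1, e2⟩ := abs_sub_riemannMap_le hA hB hs hx (a := a) (a' := a') (b := b a)
      (b' := b a') (by linarith) (by linarith) (by linarith) (by linarith)
    have e3 : |b a - b a'| = |A a x - A a' x| := by
      rw [← abs_neg]; congr 1; simp only [hb]; ring
    have e4 : |k a - k a'| ≤ |a - a'| + |B (b a) (shift 0 1 x a (A a x)) -
        B (b a') (shift 0 1 x a' (A a' x))| := by
      refine le_trans (le_of_eq ?_) (abs_add_le _ _)
      congr 1; simp only [hk]; ring
    rw [Real.dist_eq, Real.dist_eq, NNReal.coe_ofNat]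
    linarith [abs_nonneg (a - a')]
  have hle : -(c / 2) ≤ c / 2 := by linarith
  obtain ⟨a, ha, hka⟩ := intermediate_value_Icc hle hcont (show y 0 - x 0 ∈ _ by
    have e1 := (_root_.abs_le.1 (hkB _ (left_mem_Icc.2 hle)))
    have e2 := (_root_.abs_le.1 (hkB _ (right_mem_Icc.2 hle)))
    rw [abs_lt] at h0
    constructor <;> simp only [hk] <;> linarith)
  refine ⟨a, b a, by linarith [hab a ha], by linarith [hbc a ha], ?_⟩
  ext l
  fin_cases l
  · simp only [Fin.zero_eta, riemannMap_apply_zero]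
    simp only [hk] at hka
    linarith
  · simp only [Fin.mk_one, riemannMap_apply_one, hb]
    ring

variable {f : State → State} {lam : Fin 2 → State → ℝ} {r : Fin 2 → State → State}
  {ubar : State} {w : OpenPartialHomeomorph State State}

theorem riemannSolution_iff {k₁ k₂ : CurveKind} (hA : IsCubic A xbar ρ K)
    (hs : IsSmall ρ K c δ) (htarget : Metric.ball xbar ρ ⊆ w.target)
    (h1 : IsGraphOf w (WaveCurve f lam r w k₁ 0) 0 1 A xbar ρ)
    (h2 : IsGraphOf w (WaveCurve f lam r w k₂ 1) 1 0 B xbar ρ) {ul ur : State}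
    (hul : ul ∈ w.source) (hx : w ul ∈ Metric.ball xbar δ) {a b : ℝ} (ha : |a| < c)
    (hb : |b| < c) :
    RiemannSolution f lam r w k₁ k₂ a b ul ur ↔
      ur ∈ w.source ∧ w ur = riemannMap A B (w ul) a b := by
  have hc : c < ρ := by linarith [hs.c_le, hs.c_pos]
  have hm := hA.shift_mem_ball hs ha.le hx 0 1
  have hum := htarget hm
  have e := w.right_inv hum
  constructor
  · rintro ⟨um, hum1, hum2⟩
    obtain ⟨hums, hume⟩ := (h1 a (ha.trans hc) ul hul (hs.mem_ball hx) um).1 hum1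
    rw [← hume] at hm
    have := (h2 b (hb.trans hc) um hums hm ur).1 hum2
    rwa [hume] at this
  · intro h
    refine ⟨_, (h1 a (ha.trans hc) ul hul (hs.mem_ball hx) _).2 ⟨w.map_target hum, e⟩,
      (h2 b (hb.trans hc) _ (w.map_target hum) (by rwa [e]) ur).2 ?_⟩
    rwa [e]

theorem existsUnique_riemannSolution {k₁ k₂ : CurveKind} (hA : IsCubic A xbar ρ K)
    (hB : IsCubic B xbar ρ K) (hs : IsSmall ρ K c δ) (htarget : Metric.ball xbar ρ ⊆ w.target)
    (h1 : IsGraphOf w (WaveCurve f lam r w k₁ 0) 0 1 A xbar ρ)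
    (h2 : IsGraphOf w (WaveCurve f lam r w k₂ 1) 1 0 B xbar ρ) {ul ur : State}
    (hul : ul ∈ w.source) (hx : w ul ∈ Metric.ball xbar δ) (hur : ur ∈ w.source)
    (hy : w ur ∈ Metric.ball xbar δ) :
    ∃! σ : ℝ × ℝ, σ.1 ∈ Ioo (-c) c ∧ σ.2 ∈ Ioo (-c) c ∧
      RiemannSolution f lam r w k₁ k₂ σ.1 σ.2 ul ur := by
  obtain ⟨a, b, ha, hb, hab⟩ := exists_riemannMap_eq hA hB hs hx hy
  refine ⟨(a, b), ⟨abs_lt.1 ha, abs_lt.1 hb,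
    (riemannSolution_iff hA hs htarget h1 h2 hul hx ha hb).2 ⟨hur, hab⟩⟩, ?_⟩
  rintro ⟨a', b'⟩ ⟨ha', hb', hsol⟩
  rw [mem_Ioo, ← abs_lt] at ha' hb'
  have e := ((riemannSolution_iff hA hs htarget h1 h2 hul hx ha' hb').1 hsol).2
  have := riemannMap_stable hA hB hs hx ha'.le hb'.le ha.le hb.le
  rw [← e, ← hab, sub_self, sub_self, abs_zero, add_zero, mul_zero] at this
  have e1 := abs_nonneg (a' - a)
  have e2 := abs_nonneg (b' - b)
  ext
  · exact sub_eq_zero.1 (abs_eq_zero.1 (by dsimp only at *; linarith))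
  · exact sub_eq_zero.1 (abs_eq_zero.1 (by dsimp only at *; linarith))

end

/-! ### Interaction estimates -/

section

variable {xbar : State} {ρ K c δ : ℝ} {f : State → State} {lam : Fin 2 → State → ℝ}
  {r : Fin 2 → State → State} {ubar : State} {w : OpenPartialHomeomorph State State}

theorem OutgoingWaves.mono {i : Fin 2} {ul ur : State} {s a b a' b' : ℝ}
    (h : OutgoingWaves f lam r w c i ul ur s a b) (ha : a ≤ a') (hb : b ≤ b') :
    OutgoingWaves f lam r w c i ul ur s a' b' := by
  obtain ⟨τ, h1, h2, h3, h4⟩ := h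
  exact ⟨τ, h1, h2, h3.trans ha, fun j hj => (h4 j hj).trans hb⟩

/-- The common step of all interaction estimates: if the right state differs from a state on the
`i`-th Lax curve by `d` in the other Riemann coordinate only, then the outgoing wave of the other
family has strength `O(d)`. This wave changes the `i`-th Riemann coordinate by the cube of its
strength at most, hence the error `O(d ^ 3)` in the strength of the outgoing `i`-wave. -/
theorem outgoingWaves_of_eq_shift {G : Fin 2 → ℝ → State → ℝ}
    (hG : ∀ i, IsCubic (G i) xbar ρ K) (hs : IsSmall ρ K c δ)
    (htarget : Metric.ball xbar ρ ⊆ w.target)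
    (hL : ∀ i j, i ≠ j → IsGraphOf w (Lax f lam r w i) i j (G i) xbar ρ) {i j : Fin 2}
    (hij : i ≠ j) {ul ur : State}
    (hul : ul ∈ w.source) (hx : w ul ∈ Metric.ball xbar δ) (hur : ur ∈ w.source)
    (hy : w ur ∈ Metric.ball xbar δ) {s d : ℝ}
    (h : w ur = shift i j (w ul) s (G i s (w ul) + d)) :
    OutgoingWaves f lam r w c i ul ur s (8 * K * |d| ^ 3) (2 * |d|) := by
  obtain ⟨a, b, ha, hb, hab⟩ := exists_riemannMap_eq (hG 0) (hG 1) hs hx hy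
  have hsol := (riemannSolution_iff (k₁ := .lax) (k₂ := .lax) (hG 0) hs htarget
    (hL 0 1 (by decide)) (hL 1 0 (by decide)) hul hx ha hb).2 ⟨hur, hab⟩
  have hsc : |s| ≤ c := by
    have := abs_apply_sub_lt hx hy i
    rw [h, shift_apply_left hij, add_sub_cancel_left] at this
    linarith [hs.δ_le, hs.δ_pos]
  have hcρ : c < ρ := by linarith [hs.c_le, hs.c_pos]
  have h0c : |(0 : ℝ)| ≤ c := by simpa using hs.c_pos.le
  have hK := (hG 0).nonneg
  have hxρ := hs.mem_ball hx
  refine ⟨![a, b], ?_, hsol, ?_⟩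
  · intro k; fin_cases k
    · exact abs_lt.1 ha
    · exact abs_lt.1 hb
  obtain ⟨rfl, rfl⟩ | ⟨rfl, rfl⟩ : (i = 0 ∧ j = 1) ∨ (i = 1 ∧ j = 0) := by omega
  · have hst := riemannMap_stable (hG 0) (hG 1) hs hx ha.le hb.le hsc h0c
    have hm := (hG 0).shift_mem_ball hs ha.le hx 0 1
    have h0 := riemannMap_apply_zero (G 0) (G 1) (w ul) a b
    rw [← hab, riemannMap_apply_zero, riemannMap_apply_one, h, shift_apply_left (by decide),
      shift_apply_right (by decide), (hG 1).apply_zero ((hG 0).shift_mem_ball hs hsc hx 0 1)] at hst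
    rw [← hab, h, shift_apply_left (by decide)] at h0
    have hst' : |a - s| + |b| ≤ 2 * |d| := by
      refine (le_of_eq (by simp)).trans (hst.trans (le_of_eq ?_))
      rw [show w ul 0 + s - (w ul 0 + s + 0) = 0 by ring, abs_zero, zero_add]
      congr 2; ring
    have hbd : |b| ≤ 2 * |d| := by linarith [abs_nonneg (a - s)]
    refine ⟨?_, ?_⟩
    · calc |a - s| = |G 1 b (shift 0 1 (w ul) a (G 0 a (w ul)))| := by
            rw [← abs_neg]; congr 1; linarith
        _ ≤ K * |b| ^ 3 := (hG 1).bound b (hb.trans hcρ) _ hm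
        _ ≤ K * (2 * |d|) ^ 3 := by gcongr
        _ = _ := by ring
    · intro k hk
      obtain rfl : k = 1 := by omega
      exact hbd
  · have hst := riemannMap_stable (hG 0) (hG 1) hs hx ha.le hb.le h0c hsc
    have h1 := riemannMap_apply_one (G 0) (G 1) (w ul) a b
    have e0 : shift 0 1 (w ul) 0 0 = w ul := by simp [shift]
    rw [← hab, riemannMap_apply_zero, riemannMap_apply_one, h, shift_apply_left (by decide),
      shift_apply_right (by decide), (hG 0).apply_zero hxρ, e0] at hst
    rw [← hab, h, shift_apply_left (by decide)] at h1
    have hst' : |a| + |b - s| ≤ 2 * |d| := by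
      refine (le_of_eq (by simp)).trans (hst.trans (le_of_eq ?_))
      rw [show w ul 1 + s - (w ul 1 + 0 + s) = 0 by ring, abs_zero, add_zero]
      congr 2; ring
    have hbd : |a| ≤ 2 * |d| := by linarith [abs_nonneg (b - s)]
    refine ⟨?_, ?_⟩
    · calc |b - s| = |G 0 a (w ul)| := by
            rw [← abs_neg]; congr 1; linarith
        _ ≤ K * |a| ^ 3 := (hG 0).bound a (ha.trans hcρ) _ hxρ
        _ ≤ K * (2 * |d|) ^ 3 := by gcongr
        _ = _ := by ring
    · intro k hk
      obtain rfl : k = 0 := by omega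
      exact hbd

theorem shift_shift (i j : Fin 2) (x : State) (s z s' z' : ℝ) :
    shift i j (shift i j x s z) s' z' = shift i j x (s + s') (z + z') := by
  simp only [shift]; module

theorem IsRiemannCoordinates.rarefaction_apply {Ω : Set State}
    (hw : IsRiemannCoordinates Ω r ubar w) {i : Fin 2} {s : ℝ}
    {ul ur : State} (h : Rarefaction r w i s ul ur) : w ur i = w ul i + s := by
  rw [((hw.rarefaction_iff i s ul ur).1 h).2.2.1]
  simp

theorem IsRiemannCoordinates.lax_apply {Ω : Set State}
    (hw : IsRiemannCoordinates Ω r ubar w) {i : Fin 2} {s : ℝ}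
    {ul ur : State} (h : Lax f lam r w i s ul ur) : w ur i = w ul i + s := by
  rcases h with ⟨-, h⟩ | ⟨-, γ, V, -, -, -, rfl, -, h⟩
  · exact hw.rarefaction_apply h
  · exact (h s right_mem_uIcc).2.1

/-- The bounds on `d` that enter `outgoingWaves_of_eq_shift` for two Lax waves. -/
theorem IsCubic.abs_interaction_lax {G : ℝ → State → ℝ} (hG : IsCubic G xbar ρ K)
    (hs : IsSmall ρ K c δ) {x : State} (hx : x ∈ Metric.ball xbar δ) {s s' : ℝ}
    (h : |s| < c) (h' : |s'| < c) (i j : Fin 2) :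
    |G s x + G s' (shift i j x s (G s x)) - G (s + s') x| ≤
      5 * K * (|s| * |s'| * (|s| + |s'|)) := by
  have hK := hG.nonneg
  have hcρ := hs.c_le
  have hc := hs.c_pos
  have e1 := hG.second_bound s s' (by linarith) x (hs.mem_ball hx)
  have e2 := hG.lipschitz s' (by linarith) _ (hG.shift_mem_ball hs h.le hx i j) x (hs.mem_ball hx)
  have e3 : dist (shift i j x s (G s x)) x ≤ 2 * |s| := by
    have := dist_shift_le i j x s (G s x)
    have := hG.abs_le hs h.le (hs.mem_ball hx)
    linarith [abs_nonneg s]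
  have e4 : K * |s'| ^ 2 * dist (shift i j x s (G s x)) x ≤ 2 * K * (|s| * |s'| * |s'|) := by
    calc _ ≤ K * |s'| ^ 2 * (2 * |s|) := by gcongr
      _ = _ := by ring
  have e5 : 2 * K * (|s| * |s'| * |s'|) ≤ 2 * K * (|s| * |s'| * (|s| + |s'|)) := by
    gcongr; linarith [abs_nonneg s]
  have e6 : 0 ≤ K * (|s| * |s'| * (|s| + |s'|)) := by positivity
  calc _ = |(G s' (shift i j x s (G s x)) - G s' x) - (G (s + s') x - G s x - G s' x)| := by
        congr 1; ring
    _ ≤ _ := abs_sub _ _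
    _ ≤ _ := by linarith

theorem IsCubic.abs_interaction_lax_rarefaction {G : ℝ → State → ℝ} (hG : IsCubic G xbar ρ K)
    (hs : IsSmall ρ K c δ) {x : State} (hx : x ∈ Metric.ball xbar δ) {s s' : ℝ}
    (h : |s| < c) (h' : |s'| < c) :
    |G s x - G (s + s') x| ≤ 4 * K * (|s'| * (|s| + |s'|) ^ 2) := by
  have hK := hG.nonneg
  have hcρ := hs.c_le
  have hc := hs.c_pos
  have ha := abs_add_le s s'
  calc |G s x - G (s + s') x| ≤ K * |s - (s + s')| * (|s| + |s + s'|) ^ 2 :=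
        hG.sub_bound s (s + s') (by linarith) (by linarith) x (hs.mem_ball hx)
    _ = K * |s'| * (|s| + |s + s'|) ^ 2 := by
        rw [show s - (s + s') = -s' by ring, abs_neg]
    _ ≤ K * |s'| * (2 * (|s| + |s'|)) ^ 2 := by
        gcongr; linarith [abs_nonneg s']
    _ = _ := by ring

theorem IsCubic.abs_interaction_rarefaction_lax {G : ℝ → State → ℝ} (hG : IsCubic G xbar ρ K)
    (hs : IsSmall ρ K c δ) {x : State} (hx : x ∈ Metric.ball xbar δ) {s s' : ℝ}
    (h : |s| < c) (h' : |s'| < c) (i j : Fin 2) :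
    |G s (shift i j x s' 0) - G (s + s') x| ≤ 5 * K * (|s'| * (|s| + |s'|) ^ 2) := by
  have hK := hG.nonneg
  have hcρ := hs.c_le
  have hc := hs.c_pos
  have e1 := hG.abs_interaction_lax_rarefaction hs hx h h'
  have e2 := dist_shift_le i j x s' 0
  rw [abs_zero, add_zero] at e2
  have e3 : shift i j x s' 0 ∈ Metric.ball xbar ρ := by
    have := dist_triangle (shift i j x s' 0) x xbar
    rw [Metric.mem_ball] at hx ⊢
    linarith [hs.δ_le]
  have e4 := hG.lipschitz s (by linarith) _ e3 x (hs.mem_ball hx)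
  have e5 : K * |s| ^ 2 * dist (shift i j x s' 0) x ≤ K * (|s'| * (|s| + |s'|) ^ 2) := by
    calc _ ≤ K * |s| ^ 2 * |s'| := by gcongr
      _ ≤ K * (|s| + |s'|) ^ 2 * |s'| := by gcongr; linarith [abs_nonneg s']
      _ = _ := by ring
  linarith [_root_.abs_sub_le (G s (shift i j x s' 0)) (G s x) (G (s + s') x)]

end

end WaveInteraction


theorem proposition2p9 (Ω : Set State) (f : State → State) (lam : Fin 2 → State → ℝ)
    (r : Fin 2 → State → State) (hsys : IsMonotoneHyperbolic Ω f lam r)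
    (ubar : State) (w : OpenPartialHomeomorph State State)
    (hw : IsRiemannCoordinates Ω r ubar w) :
    ∃ (U : Set State) (c C : ℝ), IsRiemannNeighborhood f lam r w ubar U c ∧
      ∀ i : Fin 2, ∀ ul ∈ U, ∀ um ∈ U, ∀ ur ∈ U, ∀ σ σ' : ℝ,
        -- classical waves
        (Lax f lam r w i σ ul um → Lax f lam r w i σ' um ur →
          OutgoingWaves f lam r w c i ul ur (σ + σ')
            (C * |σ| ^ 3 * |σ'| ^ 3 * (|σ| + |σ'|) ^ 3)
            (C * |σ| * |σ'| * (|σ| + |σ'|))) ∧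
        -- a shock on the left and a compression wave on the right
        (σ < 0 → σ' < 0 → Lax f lam r w i σ ul um → Rarefaction r w i σ' um ur →
          OutgoingWaves f lam r w c i ul ur (σ + σ')
            (C * |σ'| ^ 3 * (|σ| + |σ'|) ^ 6)
            (C * |σ'| * (|σ| + |σ'|) ^ 2)) ∧
        -- a compression wave on the left and a shock on the right
        (σ < 0 → σ' < 0 → Rarefaction r w i σ' ul um → Lax f lam r w i σ um ur →
          OutgoingWaves f lam r w c i ul ur (σ + σ')
            (C * |σ'| ^ 3 * (|σ| + |σ'|) ^ 6)
            (C * |σ'| * (|σ| + |σ'|) ^ 2)) ∧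
        -- compression and rarefaction waves
        (Rarefaction r w i σ' ul um → Rarefaction r w i σ um ur →
          Rarefaction r w i (σ + σ') ul ur) := by
  obtain ⟨G₀, ρ₀, K₀, hG₀, hR₀, hL₀⟩ := hw.exists_waveCurve hsys (i := 0) (j := 1) (by decide)
  obtain ⟨G₁, ρ₁, K₁, hG₁, hR₁, hL₁⟩ := hw.exists_waveCurve hsys (i := 1) (j := 0) (by decide)
  obtain ⟨R, hRpos, hRt⟩ :=
    Metric.isOpen_iff.1 w.open_target _ (w.map_source hw.mem_source)
  set ρ := min (min ρ₀ ρ₁) R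
  have hρ : 0 < ρ := lt_min (lt_min hG₀.pos hG₁.pos) hRpos
  have hρ₀ : ρ ≤ ρ₀ := (min_le_left _ _).trans (min_le_left _ _)
  have hρ₁ : ρ ≤ ρ₁ := (min_le_left _ _).trans (min_le_right _ _)
  have htarget : Metric.ball (w ubar) ρ ⊆ w.target :=
    (Metric.ball_subset_ball (min_le_right _ _)).trans hRt
  set K := max K₀ K₁
  have hK : 0 ≤ K := hG₀.nonneg.trans (le_max_left _ _)
  set G : Fin 2 → ℝ → State → ℝ := ![G₀, G₁]
  have hG : ∀ i, IsCubic (G i) (w ubar) ρ K := by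
    intro i; fin_cases i
    · exact hG₀.mono hρ hρ₀ (le_max_left _ _)
    · exact hG₁.mono hρ hρ₁ (le_max_right _ _)
  have hL : ∀ i j, i ≠ j → IsGraphOf w (Lax f lam r w i) i j (G i) (w ubar) ρ := by
    intro i j hij
    obtain ⟨rfl, rfl⟩ | ⟨rfl, rfl⟩ : (i = 0 ∧ j = 1) ∨ (i = 1 ∧ j = 0) := by omega
    · exact hL₀.mono hρ₀
    · exact hL₁.mono hρ₁
  have hR : ∀ i j, i ≠ j → IsGraphOf w (Rarefaction r w i) i j (fun _ _ => 0) (w ubar) ρ := by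
    intro i j hij
    obtain ⟨rfl, rfl⟩ | ⟨rfl, rfl⟩ : (i = 0 ∧ j = 1) ∨ (i = 1 ∧ j = 0) := by omega
    · exact hR₀.mono hρ₀
    · exact hR₁.mono hρ₁
  have hwave : ∀ (k : CurveKind) (i j : Fin 2), i ≠ j → ∃ A, IsCubic A (w ubar) ρ K ∧
      IsGraphOf w (WaveCurve f lam r w k i) i j A (w ubar) ρ := by
    rintro (_ | _) i j hij
    · exact ⟨_, isCubic_zero hρ hK, hR i j hij⟩
    · exact ⟨_, hG i, hL i j hij⟩
  -- `c ≤ 1 / (32 * (K + 1))` makes the cubic functions Lipschitz with a small constant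
  set c := min (ρ / 3) (1 / (32 * (K + 1)))
  have hc : 0 < c := lt_min (by positivity) (by positivity)
  have hsmall : IsSmall ρ K c (c / 16) := by
    refine ⟨hc, by linarith [(min_le_left _ _ : c ≤ ρ / 3)], ?_, by positivity, by linarith⟩
    have h1 : c * (32 * (K + 1)) ≤ 1 := (le_div_iff₀ (by positivity)).1 (min_le_right _ _)
    nlinarith
  -- `|d| ≤ 5 * K * D` gives the errors `8 * K * (5 * K * D) ^ 3` and `2 * (5 * K * D)`
  refine ⟨w.source ∩ w ⁻¹' Metric.ball (w ubar) (c / 16), c, 1000 * K ^ 4 + 10 * K,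
    ⟨w.isOpen_inter_preimage Metric.isOpen_ball,
      ⟨hw.mem_source, Metric.mem_ball_self hsmall.δ_pos⟩, Set.inter_subset_left, hc, ?_⟩, ?_⟩
  · rintro k₁ k₂ ul ⟨hul, hx⟩ ur ⟨hur, hy⟩
    obtain ⟨A, hA, hA'⟩ := hwave k₁ 0 1 (by decide)
    obtain ⟨B, hB, hB'⟩ := hwave k₂ 1 0 (by decide)
    exact existsUnique_riemannSolution hA hB hsmall htarget hA' hB' hul hx hur hy
  · rintro i ul ⟨hul, hx⟩ um ⟨hum, hm⟩ ur ⟨hur, hy⟩ σ σ'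
    obtain ⟨j, hij⟩ : ∃ j : Fin 2, i ≠ j := ⟨i + 1, by omega⟩
    have hcρ : c < ρ := by linarith [hsmall.c_le]
    have strength : ∀ {u v : State} {s : ℝ}, w u ∈ Metric.ball (w ubar) (c / 16) →
        w v ∈ Metric.ball (w ubar) (c / 16) → w v i = w u i + s → |s| < c := by
      intro u v s hu hv h
      have := abs_apply_sub_lt hu hv i
      rw [h, add_sub_cancel_left] at this
      linarith
    have conclude : ∀ d D : ℝ, 0 ≤ D → |d| ≤ 5 * K * D →
        w ur = shift i j (w ul) (σ + σ') (G i (σ + σ') (w ul) + d) →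
        OutgoingWaves f lam r w c i ul ur (σ + σ') ((1000 * K ^ 4 + 10 * K) * D ^ 3)
          ((1000 * K ^ 4 + 10 * K) * D) := by
      intro d D hD hd h
      refine (outgoingWaves_of_eq_shift hG hsmall htarget hL hij hul hx hur hy h).mono ?_ ?_
      · calc 8 * K * |d| ^ 3 ≤ 8 * K * (5 * K * D) ^ 3 := by gcongr
          _ = 1000 * K ^ 4 * D ^ 3 := by ring
          _ ≤ _ := by gcongr; linarith
      · calc 2 * |d| ≤ 2 * (5 * K * D) := by gcongr
          _ = 10 * K * D := by ring
          _ ≤ _ := by gcongr; linarith [pow_nonneg hK 4]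
    refine ⟨fun h1 h2 => ?_, fun _ _ h1 h2 => ?_, fun _ _ h1 h2 => ?_,
      fun h1 h2 => hw.rarefaction_trans h1 h2⟩
    · have hσ := strength hx hm (hw.lax_apply h1)
      have hσ' := strength hm hy (hw.lax_apply h2)
      have e1 := ((hL i j hij σ (hσ.trans hcρ) ul hul (hsmall.mem_ball hx) um).1 h1).2
      have e2 := ((hL i j hij σ' (hσ'.trans hcρ) um hum (hsmall.mem_ball hm) ur).1 h2).2
      convert! conclude _ (|σ| * |σ'| * (|σ| + |σ'|)) (by positivity)
        ((hG i).abs_interaction_lax hsmall hx hσ hσ' i j) ?_ using 1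
      · ring
      · ring
      · rw [e2, e1, shift_shift, add_sub_cancel]
    · have hσ := strength hx hm (hw.lax_apply h1)
      have hσ' := strength hm hy (hw.rarefaction_apply h2)
      have e1 := ((hL i j hij σ (hσ.trans hcρ) ul hul (hsmall.mem_ball hx) um).1 h1).2
      have e2 := ((hR i j hij σ' (hσ'.trans hcρ) um hum (hsmall.mem_ball hm) ur).1 h2).2
      convert! conclude _ (|σ'| * (|σ| + |σ'|) ^ 2) (by positivity)
        (((hG i).abs_interaction_lax_rarefaction hsmall hx hσ hσ').trans
          (by gcongr; norm_num)) ?_ using 1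
      · ring
      · ring
      · rw [e2, e1, shift_shift, add_sub_cancel, add_zero]
    · have hσ' := strength hx hm (hw.rarefaction_apply h1)
      have hσ := strength hm hy (hw.lax_apply h2)
      have e1 := ((hR i j hij σ' (hσ'.trans hcρ) ul hul (hsmall.mem_ball hx) um).1 h1).2
      have e2 := ((hL i j hij σ (hσ.trans hcρ) um hum (hsmall.mem_ball hm) ur).1 h2).2
      convert! conclude _ (|σ'| * (|σ| + |σ'|) ^ 2) (by positivity)
        ((hG i).abs_interaction_rarefaction_lax hsmall hx hσ hσ' i j) ?_ using 1
      · ring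
      · ring
      · rw [e2, e1, shift_shift, add_sub_cancel, zero_add, add_comm σ' σ]
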